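/- Let $\mathrm{PV}_1$ be the universal first-order theory of polynomial-time reasoning. Its language has a function symbol for every polynomial-time function, generated from $0, S, +, \cdot, \#, \lfloor x/2\rfloor, |x|$ and the characteristic function of $\le$ by composition and limited recursion on notation. Its axioms are those of $\mathrm{BASIC}$, the defining equations of all function symbols, and induction on notation for open formulas. Here $|x|$ is the length of the binary representation of $x$, and $1^{(k)}$ denotes the number whose binary representation consists of exactly $k$ ones. The following $\mathrm{PV}$-symbols are computed by the usual polynomial-time algorithms: $\mathrm{NumOnes}(x)$, the number of ones in the binary expansion of $x$; $c^m_k(x)$, the characteristic function (given $1^{(k)}$ and $1^{(m)}$) of the predicate "$|x|\le m$ and $\mathrm{NumOnes}(x)=k$"; and the binomial coefficient $\binom{m}{k}=\left\lfloor \frac{m!}{k!\,(m-k)!}\right\rfloor$ for $k \le m$, as a function of $1^{(m)}$ and $1^{(k)}$. Lemma (combinatorial number system). There is a $\mathrm{PV}$-symbol $f$, whose value $f(1^{(k)},1^{(m)},i)$ is written $f_k^m(i)$, such that $\mathrm{PV}_1$ proves: for any numbers $1^{(k)}$ and $1^{(m)}$ with $0\le k\le m$, $$f_k^m:\ \Big\{\,i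 : 0<i\le \tbinom{m}{k}\Big\}\ \longrightarrow\ \{\,x : c_k^m(x)=1\,\}$$ is an injective function. That is, $\mathrm{PV}_1$ proves that $c^m_k(f^m_k(i))=1$ whenever $0<i\le\binom mk$, and that $i=j$ whenever $0<i,j\le\binom mk$ and $f^m_k(i)=f^m_k(j)$. -/

import Mathlib

open FirstOrder FirstOrder.Language

/-- The function symbols of `PV`, by arity: the symbols of Buss' language `0, S, +, ·, ≤, #, ⌊x/2⌋, |x|`
(the order through its characteristic function `leq`), closed under composition and under limited
recursion on notation. -/
inductive PVFun : ℕ → Type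
  | zero : PVFun 0
  | succ : PVFun 1
  | add : PVFun 2
  | mul : PVFun 2
  | smash : PVFun 2
  | half : PVFun 1
  | len : PVFun 1
  | leq : PVFun 2
  | proj {n : ℕ} (i : Fin n) : PVFun n
  | comp {m n : ℕ} (f : PVFun m) (g : Fin m → PVFun n) : PVFun n
  /-- The function `f` with `f(0, x⃗) = g(x⃗)` and, for `i = 0, 1` and `2y + i ≠ 0`,
  `f(2y + i, x⃗) = min (hᵢ(y, f(y, x⃗), x⃗)) (k(2y + i, x⃗))`. -/
  | lrn {n : ℕ} (g : PVFun n) (h₀ h₁ : PVFun (n + 2)) (k : PVFun (n + 1)) : PVFun (n + 1)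

/-- The first-order language of `PV`; its only relation symbol is equality. -/
def pvLang : Language := ⟨PVFun, fun _ => Empty⟩

namespace PV

/-! ### Terms and formulas -/

section Terms

variable {α : Type}

/-- The function symbol `f` applied to terms. -/
def app {n : ℕ} (f : PVFun n) (ts : Fin n → pvLang.Term α) : pvLang.Term α :=
  Term.func (L := pvLang) f ts

def zero : pvLang.Term α := app PVFun.zero ![]
def succ (s : pvLang.Term α) : pvLang.Term α := app PVFun.succ ![s]
def add (s t : pvLang.Term α) : pvLang.Term α := app PVFun.add ![s, t]
def mul (s t : pvLang.Term α) : pvLang.Term α := app PVFun.mul ![s, t]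
def smash (s t : pvLang.Term α) : pvLang.Term α := app PVFun.smash ![s, t]
def half (s : pvLang.Term α) : pvLang.Term α := app PVFun.half ![s]
def len (s : pvLang.Term α) : pvLang.Term α := app PVFun.len ![s]
def leq (s t : pvLang.Term α) : pvLang.Term α := app PVFun.leq ![s, t]

/-- The numeral `1 = S(0)`. -/
def one : pvLang.Term α := succ zero

/-- The term `S(S(0)) · s`. -/
def dbl (s : pvLang.Term α) : pvLang.Term α := mul (succ one) s

/-- The formula `s = t`. -/
def eq (s t : pvLang.Term α) : pvLang.Formula α := Term.equal s t

/-- The formula `s ≤ t`, that is, `leq(s, t) = 1`. -/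
def le (s t : pvLang.Term α) : pvLang.Formula α := eq (leq s t) one

/-- The formula `s ≠ t`. -/
def ne (s t : pvLang.Term α) : pvLang.Formula α := ∼(eq s t)

/-- The variable with index `i`. -/
def v {n : ℕ} (i : Fin n) : pvLang.Term (Fin n) := Term.var i

end Terms

/-! ### The theory `PV₁` -/

/-- The 32 axioms of `BASIC`, with the variables `v 0, …, v 3`. -/
inductive Basic : pvLang.Formula (Fin 4) → Prop
  | b1 : Basic (le (v 1) (v 0) ⟹ le (v 1) (succ (v 0)))
  | b2 : Basic (ne (v 0) (succ (v 0)))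
  | b3 : Basic (le zero (v 0))
  | b4 : Basic ((le (v 0) (v 1) ⊓ ne (v 0) (v 1)).iff (le (succ (v 0)) (v 1)))
  | b5 : Basic (ne (v 0) zero ⟹ ne (dbl (v 0)) zero)
  | b6 : Basic (le (v 1) (v 0) ⊔ le (v 0) (v 1))
  | b7 : Basic (le (v 0) (v 1) ⊓ le (v 1) (v 0) ⟹ eq (v 0) (v 1))
  | b8 : Basic (le (v 0) (v 1) ⊓ le (v 1) (v 2) ⟹ le (v 0) (v 2))
  | b9 : Basic (eq (len zero) zero)
  | b10 : Basic (ne (v 0) zero ⟹ eq (len (dbl (v 0))) (succ (len (v 0))) ⊓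
      eq (len (succ (dbl (v 0)))) (succ (len (v 0))))
  | b11 : Basic (eq (len one) one)
  | b12 : Basic (le (v 0) (v 1) ⟹ le (len (v 0)) (len (v 1)))
  | b13 : Basic (eq (len (smash (v 0) (v 1))) (succ (mul (len (v 0)) (len (v 1)))))
  | b14 : Basic (eq (smash zero (v 0)) one)
  | b15 : Basic (ne (v 0) zero ⟹ eq (smash one (dbl (v 0))) (dbl (smash one (v 0))) ⊓
      eq (smash one (succ (dbl (v 0)))) (dbl (smash one (v 0))))
  | b16 : Basic (eq (smash (v 0) (v 1)) (smash (v 1) (v 0)))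
  | b17 : Basic (eq (len (v 0)) (len (v 1)) ⟹ eq (smash (v 0) (v 2)) (smash (v 1) (v 2)))
  | b18 : Basic (eq (len (v 0)) (add (len (v 1)) (len (v 2))) ⟹
      eq (smash (v 0) (v 3)) (mul (smash (v 1) (v 3)) (smash (v 2) (v 3))))
  | b19 : Basic (le (v 0) (add (v 0) (v 1)))
  | b20 : Basic (le (v 0) (v 1) ⊓ ne (v 0) (v 1) ⟹
      le (succ (dbl (v 0))) (dbl (v 1)) ⊓ ne (succ (dbl (v 0))) (dbl (v 1)))
  | b21 : Basic (eq (add (v 0) (v 1)) (add (v 1) (v 0)))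
  | b22 : Basic (eq (add (v 0) zero) (v 0))
  | b23 : Basic (eq (add (v 0) (succ (v 1))) (succ (add (v 0) (v 1))))
  | b24 : Basic (eq (add (add (v 0) (v 1)) (v 2)) (add (v 0) (add (v 1) (v 2))))
  | b25 : Basic ((le (add (v 0) (v 1)) (add (v 0) (v 2))).iff (le (v 1) (v 2)))
  | b26 : Basic (eq (mul (v 0) zero) zero)
  | b27 : Basic (eq (mul (v 0) (succ (v 1))) (add (mul (v 0) (v 1)) (v 0)))
  | b28 : Basic (eq (mul (v 0) (v 1)) (mul (v 1) (v 0)))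
  | b29 : Basic (eq (mul (v 0) (add (v 1) (v 2))) (add (mul (v 0) (v 1)) (mul (v 0) (v 2))))
  | b30 : Basic (le one (v 0) ⟹
      (le (mul (v 0) (v 1)) (mul (v 0) (v 2))).iff (le (v 1) (v 2)))
  | b31 : Basic (ne (v 0) zero ⟹ eq (len (v 0)) (succ (len (half (v 0)))))
  | b32 : Basic ((eq (v 0) (half (v 1))).iff
      (eq (dbl (v 0)) (v 1) ⊔ eq (succ (dbl (v 0))) (v 1)))

/-- `t₀ = min t₁ t₂`, as a formula. -/
def isMin {α : Type} (t₀ t₁ t₂ : pvLang.Term α) : pvLang.Formula α :=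
  (le t₁ t₂ ⟹ eq t₀ t₁) ⊓ (∼(le t₁ t₂) ⟹ eq t₀ t₂)

/-- Induction on notation for `φ(x⃗, y)`, where `x⃗` is indexed by `Fin n`:
`φ(x⃗, 0) → ∀ y (φ(x⃗, ⌊y/2⌋) → φ(x⃗, y)) → ∀ y φ(x⃗, y)`. -/
noncomputable def pind {n : ℕ} (φ : pvLang.Formula (Fin n ⊕ Fin 1)) : pvLang.Formula (Fin n) :=
  let base : pvLang.Formula (Fin n) := φ.subst (Sum.elim Term.var fun _ => zero)
  let prev : pvLang.Formula (Fin n ⊕ Fin 1) :=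
    φ.subst (Sum.elim (fun i => Term.var (Sum.inl i)) fun j => half (Term.var (Sum.inr j)))
  base ⟹ Formula.iAlls (Fin 1) (prev ⟹ φ) ⟹ Formula.iAlls (Fin 1) φ

/-- The axioms of `PV₁`, without the outer universal quantifiers: `BASIC`, the defining equations of
all function symbols, and induction on notation for all open formulas. -/
inductive Axiom : {n : ℕ} → pvLang.Formula (Fin n) → Prop
  | basic {φ : pvLang.Formula (Fin 4)} (h : Basic φ) : Axiom φ
  | leq_char : Axiom (n := 2) (eq (leq (v 0) (v 1)) zero ⊔ eq (leq (v 0) (v 1)) one)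
  | proj {n : ℕ} (i : Fin n) : Axiom (eq (app (PVFun.proj i) v) (v i))
  | comp {m n : ℕ} (f : PVFun m) (g : Fin m → PVFun n) :
      Axiom (eq (app (PVFun.comp f g) v) (app f fun i => app (g i) v))
  | lrn_zero {n : ℕ} (g : PVFun n) (h₀ h₁ : PVFun (n + 2)) (k : PVFun (n + 1)) :
      Axiom (eq (app (PVFun.lrn g h₀ h₁ k) (Matrix.vecCons zero v)) (app g v))
  | lrn_even {n : ℕ} (g : PVFun n) (h₀ h₁ : PVFun (n + 2)) (k : PVFun (n + 1)) :
      Axiom (n := n + 1)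
        (let y := v 0
         let x : Fin n → pvLang.Term (Fin (n + 1)) := fun i => v i.succ
         let f := app (PVFun.lrn g h₀ h₁ k)
         ne (dbl y) zero ⟹
          isMin (f (Matrix.vecCons (dbl y) x))
            (app h₀ (Matrix.vecCons y (Matrix.vecCons (f (Matrix.vecCons y x)) x)))
            (app k (Matrix.vecCons (dbl y) x)))
  | lrn_odd {n : ℕ} (g : PVFun n) (h₀ h₁ : PVFun (n + 2)) (k : PVFun (n + 1)) :
      Axiom (n := n + 1)
        (let y := v 0
         let x : Fin n → pvLang.Term (Fin (n + 1)) := fun i => v i.succ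
         let f := app (PVFun.lrn g h₀ h₁ k)
         isMin (f (Matrix.vecCons (succ (dbl y)) x))
            (app h₁ (Matrix.vecCons y (Matrix.vecCons (f (Matrix.vecCons y x)) x)))
            (app k (Matrix.vecCons (succ (dbl y)) x)))
  | pind {n : ℕ} (φ : pvLang.Formula (Fin n ⊕ Fin 1)) (h : BoundedFormula.IsQF φ) : Axiom (pind φ)

/-- The universal closure. -/
noncomputable def closure {n : ℕ} (φ : pvLang.Formula (Fin n)) : pvLang.Sentence :=
  Formula.iAlls (Fin n) (φ.relabel (Sum.inr : Fin n → Empty ⊕ Fin n))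

/-- The first-order theory `PV₁`. -/
def PV1 : pvLang.Theory :=
  {ψ | ∃ (n : ℕ) (φ : pvLang.Formula (Fin n)), Axiom φ ∧ ψ = closure φ}

/-! ### Particular function symbols -/

section Symbols

variable {n : ℕ}

def zeroF : PVFun n := .comp .zero ![]
def succF (f : PVFun n) : PVFun n := .comp .succ ![f]
def addF (f g : PVFun n) : PVFun n := .comp .add ![f, g]
def mulF (f g : PVFun n) : PVFun n := .comp .mul ![f, g]
def smashF (f g : PVFun n) : PVFun n := .comp .smash ![f, g]
def halfF (f : PVFun n) : PVFun n := .comp .half ![f]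
def lenF (f : PVFun n) : PVFun n := .comp .len ![f]
def leqF (f g : PVFun n) : PVFun n := .comp .leq ![f, g]
def dblF (f : PVFun n) : PVFun n := mulF (succF (succF zeroF)) f

end Symbols

/-- `NumOnes(x)`, the number of ones in the binary expansion of `x`:
`NumOnes(0) = 0`, `NumOnes(2y) = NumOnes(y)`, `NumOnes(2y + 1) = NumOnes(y) + 1`. -/
def numOnes : PVFun 1 :=
  .lrn zeroF (.proj 1) (succF (.proj 1)) (.proj 0)

/-- `Fact(x) = |x|!`: `Fact(0) = 1` and `Fact(2y + i) = Fact(y) · (|y| + 1)`. -/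
def fact : PVFun 1 :=
  let step : PVFun 2 := mulF (.proj 1) (succF (lenF (.proj 0)))
  .lrn (succF zeroF) step step (smashF (.proj 0) (.proj 0))

/-- `div(x, d) = ⌊x / d⌋` for `d ≠ 0`, by long division: `div(0, d) = 0`, and with `q = div(y, d)`,
`div(2y + i, d)` is `2q + 1` if `d · (2q + 1) ≤ 2y + i`, and `2q` otherwise. -/
def div : PVFun 2 :=
  let q : PVFun 3 := dblF (.proj 1)
  let step (x : PVFun 3) : PVFun 3 := addF q (leqF (mulF (.proj 2) (succF q)) x)
  .lrn zeroF (step (dblF (.proj 0))) (step (succF (dblF (.proj 0)))) (.proj 0)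

/-- `shift(u, x) = ⌊x / 2 ^ |u|⌋`: `shift(0, x) = x` and `shift(2y + i, x) = ⌊shift(y, x) / 2⌋`. -/
def shift : PVFun 2 :=
  .lrn (.proj 0) (halfF (.proj 1)) (halfF (.proj 1)) (.proj 1)

/-- The binomial coefficient for `m` and `k` in unary: `binom(1^(m), 1^(k))` is
`⌊m! / (k! · (m - k)!)⌋` for `k ≤ m`, and `0` otherwise. For `k ≤ m`, the number `1^(m - k)` is
`shift(1^(k), 1^(m))`. -/
def binom : PVFun 2 :=
  let m : PVFun 2 := .proj 0
  let k : PVFun 2 := .proj 1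
  let factF (f : PVFun 2) : PVFun 2 := .comp fact ![f]
  mulF (leqF (lenF k) (lenF m))
    (.comp div ![factF m, mulF (factF k) (factF (.comp shift ![k, m])) ])

/-- The characteristic function `c(1^(k), 1^(m), x)` of the predicate
`|x| ≤ m ∧ NumOnes(x) = k`. -/
def cSym : PVFun 3 :=
  let k : PVFun 3 := lenF (.proj 0)
  let m : PVFun 3 := lenF (.proj 1)
  let ones : PVFun 3 := .comp numOnes ![.proj 2]
  mulF (leqF (lenF (.proj 2)) m) (mulF (leqF ones k) (leqF k ones))

/-! ### The formula -/

section Formulas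

variable {α : Type}

/-- `u` is of the form `1^(k)`, where `k = |u|`: all binary digits of `u` are ones. -/
def isUnary (u : pvLang.Term α) : pvLang.Formula α := eq (app numOnes ![u]) (len u)

/-- `0 < i ≤ binom(m, k)`, where `u = 1^(k)` and `w = 1^(m)`. -/
def inDomain (u w i : pvLang.Term α) : pvLang.Formula α :=
  (le zero i ⊓ ne zero i) ⊓ le i (app binom ![w, u])

/-- With `u = v 0`, `w = v 1`, `i = v 2`, `j = v 3`: if `u = 1^(k)`, `w = 1^(m)` and `k ≤ m`, then
`x ↦ f(u, w, x)` maps every `i` with `0 < i ≤ binom(m, k)` to an `x` with `c(u, w, x) = 1`, and takes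
different values at different such `i` and `j`. -/
def injectsBinom (f : PVFun 3) : pvLang.Formula (Fin 4) :=
  let u := v 0
  let w := v 1
  let i := v 2
  let j := v 3
  isUnary u ⊓ isUnary w ⊓ le (len u) (len w) ⟹
    (inDomain u w i ⟹ eq (app cSym ![u, w, app f ![u, w, i] ]) one) ⊓
    (inDomain u w i ⊓ inDomain u w j ⊓ eq (app f ![u, w, i]) (app f ![u, w, j]) ⟹ eq i j)

end Formulas

end PV

/-! The consequence is checked semantically, in an arbitrary model of `PV1`. The witness `unrank`
lists the words of length m with k ones in lexicographic order, most significant digit first.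
Suppose a prefix has r + 1 digits to go and s ones missing. Its extensions by 0 come first and there
are binom(r, s) of them, so the next digit is 1 exactly when i exceeds the number of words before
the prefix (`rank`) by more than binom(r, s). This keeps the invariant

rank < i ≤ rank + binom(remaining digits, missing ones),

which is part of `IsPrefix`; for the digit 1 it is preserved by Pascal's identity. When no digit
remains, binom(0, s) is nonzero only for s = 0. Hence the output has exactly k ones, and i = rank +
1, where the rank is computed from the output alone (`ur_spec`). Thus i can be read off from its
image, and injectivity follows without any counting.

What remains is to carry this out with induction on notation for open formulas. The BASIC axioms and
this induction make a model a commutative ordered semiring. Open predicates have characteristic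
functions that are terms, so induction on equations covers them all. Pascal's identity needs the
division in m! / (k! (m - k)!) to be exact. This is proved by induction on m for all k ≤ m at once,
and the quantifier over k has to be hidden in a function symbol to keep the induction hypothesis
open: `allLe` does this, and `exists_mul_fc` is the resulting divisibility. -/

namespace PV

/-! ### Evaluation of terms and formulas -/

section Realize

variable {M : Type} [pvLang.Structure M]

/-- The interpretation of a function symbol of `PV`. -/
def ev {n : ℕ} (F : PVFun n) (a : Fin n → M) : M :=
  Structure.funMap (L := pvLang) F a

variable {α : Type} (a : α → M)

theorem realize_app {n : ℕ} (F : PVFun n) (ts : Fin n → pvLang.Term α) :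
    (app F ts).realize a = ev F fun i => (ts i).realize a := rfl

theorem realize_cons {n : ℕ} (s : pvLang.Term α) (ts : Fin n → pvLang.Term α) :
    (fun i => (Matrix.vecCons s ts i).realize a) =
      Matrix.vecCons (s.realize a) fun i => (ts i).realize a := by
  funext i
  cases i using Fin.cases <;> rfl

theorem realize_nil (ts : Fin 0 → pvLang.Term α) : (fun i => (ts i).realize a) = ![] :=
  Subsingleton.elim _ _

instance : Zero M := ⟨ev PVFun.zero ![]⟩
instance : One M := ⟨ev PVFun.succ ![0]⟩
instance : Add M := ⟨fun x y => ev PVFun.add ![x, y]⟩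
instance : Mul M := ⟨fun x y => ev PVFun.mul ![x, y]⟩
instance : LE M := ⟨fun x y => ev PVFun.leq ![x, y] = 1⟩

/-- The successor in a model. -/
def S (x : M) : M := ev PVFun.succ ![x]

/-- The value `⌊x/2⌋` in a model. -/
def hf (x : M) : M := ev PVFun.half ![x]

/-- The length of the binary representation in a model. -/
def ln (x : M) : M := ev PVFun.len ![x]

/-- The characteristic function of `≤` in a model. -/
def lq (x y : M) : M := ev PVFun.leq ![x, y]

/-- The smash function in a model. -/
def sm (x y : M) : M := ev PVFun.smash ![x, y]

theorem lq_eq_one {x y : M} : lq x y = 1 ↔ x ≤ y := Iff.rfl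

theorem realize_var {n : ℕ} (a : Fin n → M) (i : Fin n) : (v i).realize a = a i := rfl

theorem realize_zero : (zero : pvLang.Term α).realize a = 0 := by
  simp only [zero, realize_app, realize_nil]; rfl

theorem realize_succ (s : pvLang.Term α) : (succ s).realize a = S (s.realize a) := by
  simp only [succ, realize_app, realize_cons, realize_nil]; rfl

theorem realize_one : (one : pvLang.Term α).realize a = 1 := by
  simp only [one, realize_succ, realize_zero]; rfl

theorem realize_add (s t : pvLang.Term α) :
    (add s t).realize a = s.realize a + t.realize a := by
  simp only [add, realize_app, realize_cons, realize_nil]; rfl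

theorem realize_mul (s t : pvLang.Term α) :
    (mul s t).realize a = s.realize a * t.realize a := by
  simp only [mul, realize_app, realize_cons, realize_nil]; rfl

theorem realize_smash (s t : pvLang.Term α) :
    (smash s t).realize a = sm (s.realize a) (t.realize a) := by
  simp only [smash, realize_app, realize_cons, realize_nil]; rfl

theorem realize_half (s : pvLang.Term α) : (half s).realize a = hf (s.realize a) := by
  simp only [half, realize_app, realize_cons, realize_nil]; rfl

theorem realize_len (s : pvLang.Term α) : (len s).realize a = ln (s.realize a) := by
  simp only [len, realize_app, realize_cons, realize_nil]; rfl

theorem realize_leq (s t : pvLang.Term α) :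
    (leq s t).realize a = lq (s.realize a) (t.realize a) := by
  simp only [leq, realize_app, realize_cons, realize_nil]; rfl

theorem realize_dbl (s : pvLang.Term α) : (dbl s).realize a = S 1 * s.realize a := by
  simp only [dbl, realize_mul, realize_succ, realize_one]

theorem realize_eq (s t : pvLang.Term α) :
    (eq s t).Realize a ↔ s.realize a = t.realize a :=
  Formula.realize_equal

theorem realize_le (s t : pvLang.Term α) :
    (le s t).Realize a ↔ s.realize a ≤ t.realize a := by
  simp only [le, realize_eq, realize_leq, realize_one, lq_eq_one]

theorem realize_ne (s t : pvLang.Term α) :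
    (ne s t).Realize a ↔ s.realize a ≠ t.realize a := by
  simp only [ne, Formula.realize_not, realize_eq, Ne]

theorem realize_sup (φ ψ : pvLang.Formula α) :
    Formula.Realize (φ ⊔ ψ) a ↔ φ.Realize a ∨ ψ.Realize a :=
  BoundedFormula.realize_sup

theorem realize_closure {n : ℕ} (φ : pvLang.Formula (Fin n)) :
    M ⊨ closure φ ↔ ∀ a : Fin n → M, φ.Realize a := by
  simp only [closure, Sentence.Realize, Formula.realize_iAlls, Formula.realize_relabel]
  rfl

end Realize

/-! ### Induction on notation -/

section TermFun

variable {M : Type} [pvLang.Structure M]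

/-- A function on a model that is given by a term with parameters. -/
def TermFun (g : M → M) : Prop :=
  ∃ t : pvLang.Term (M ⊕ Fin 1), ∀ x, g x = t.realize (Sum.elim id fun _ => x)

theorem TermFun.id : TermFun fun x : M => x := ⟨Term.var (.inr 0), fun _ => rfl⟩

theorem TermFun.const (c : M) : TermFun fun _ : M => c := ⟨Term.var (.inl c), fun _ => rfl⟩

theorem TermFun.ev {n : ℕ} (F : PVFun n) {g : Fin n → M → M} (hg : ∀ i, TermFun (g i)) :
    TermFun fun x => ev F fun i => g i x := by
  choose t ht using hg
  exact ⟨app F t, fun x => by simp only [realize_app, ht]⟩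

theorem TermFun.ev_one (F : PVFun 1) {g : M → M} (hg : TermFun g) :
    TermFun fun x => PV.ev F ![g x] := by
  convert TermFun.ev F (g := ![g]) ?_ using 3 with x
  · funext i; fin_cases i; rfl
  · intro i; fin_cases i; exact hg

theorem TermFun.ev_two (F : PVFun 2) {g h : M → M} (hg : TermFun g) (hh : TermFun h) :
    TermFun fun x => PV.ev F ![g x, h x] := by
  convert TermFun.ev F (g := ![g, h]) ?_ using 3 with x
  · funext i; fin_cases i <;> rfl
  · intro i; fin_cases i; exacts [hg, hh]

theorem TermFun.ev_three (F : PVFun 3) {g h k : M → M} (hg : TermFun g) (hh : TermFun h)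
    (hk : TermFun k) : TermFun fun x => PV.ev F ![g x, h x, k x] := by
  convert TermFun.ev F (g := ![g, h, k]) ?_ using 3 with x
  · funext i; fin_cases i <;> rfl
  · intro i; fin_cases i; exacts [hg, hh, hk]

theorem TermFun.ev_four (F : PVFun 4) {g h k l : M → M} (hg : TermFun g) (hh : TermFun h)
    (hk : TermFun k) (hl : TermFun l) : TermFun fun x => PV.ev F ![g x, h x, k x, l x] := by
  convert TermFun.ev F (g := ![g, h, k, l]) ?_ using 3 with x
  · funext i; fin_cases i <;> rfl
  · intro i; fin_cases i; exacts [hg, hh, hk, hl]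

theorem TermFun.add {g h : M → M} (hg : TermFun g) (hh : TermFun h) :
    TermFun fun x => g x + h x := hg.ev_two PVFun.add hh

theorem TermFun.mul {g h : M → M} (hg : TermFun g) (hh : TermFun h) :
    TermFun fun x => g x * h x := hg.ev_two PVFun.mul hh

theorem TermFun.hf {g : M → M} (hg : TermFun g) : TermFun fun x => hf (g x) :=
  hg.ev_one PVFun.half

theorem TermFun.ln {g : M → M} (hg : TermFun g) : TermFun fun x => ln (g x) :=
  hg.ev_one PVFun.len

theorem TermFun.lq {g h : M → M} (hg : TermFun g) (hh : TermFun h) :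
    TermFun fun x => lq (g x) (h x) := hg.ev_two PVFun.leq hh

theorem TermFun.sm {g h : M → M} (hg : TermFun g) (hh : TermFun h) :
    TermFun fun x => sm (g x) (h x) := hg.ev_two PVFun.smash hh

/-- A predicate on a model that is given by an equation between terms with parameters. -/
def EqPred (P : M → Prop) : Prop :=
  ∃ g h : M → M, TermFun g ∧ TermFun h ∧ ∀ x, P x ↔ g x = h x

theorem EqPred.of_eq {g h : M → M} (hg : TermFun g) (hh : TermFun h) :
    EqPred fun x => g x = h x := ⟨g, h, hg, hh, fun _ => Iff.rfl⟩

end TermFun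

section Axioms

variable {M : Type} [pvLang.Structure M] [hM : M ⊨ PV1]

theorem realize_of_mem_axioms {n : ℕ} {φ : pvLang.Formula (Fin n)} (h : Axiom φ) (a : Fin n → M) :
    φ.Realize a :=
  (realize_closure φ).1 (hM.realize_of_mem _ ⟨n, φ, h, rfl⟩) a

theorem realize_basic {φ : pvLang.Formula (Fin 4)} (h : Basic φ) (a : Fin 4 → M) :
    φ.Realize a :=
  realize_of_mem_axioms (.basic h) a

theorem half_induction {P : M → Prop} (hP : EqPred P) (h0 : P 0)
    (hs : ∀ y, P (hf y) → P y) (y : M) : P y := by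
  obtain ⟨g, h, ⟨s, hs'⟩, ⟨t, ht'⟩, hP⟩ := hP
  classical
  -- Only finitely many parameters from the model occur in the two terms; numbering them by `Fin n`
  -- gives an instance of the axiom.
  obtain ⟨n, ⟨e⟩⟩ := Finite.exists_equiv_fin
    (s.varFinsetLeft ∪ t.varFinsetLeft : Finset M)
  let p : Fin n → M := fun i => (e.symm i : M)
  let s' : pvLang.Term (Fin n ⊕ Fin 1) :=
    s.restrictVarLeft fun b => e ⟨b, Finset.mem_union_left _ b.2⟩
  let t' : pvLang.Term (Fin n ⊕ Fin 1) :=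
    t.restrictVarLeft fun b => e ⟨b, Finset.mem_union_right _ b.2⟩
  have es (x : M) : s'.realize (Sum.elim p fun _ => x) = g x := by
    rw [hs', Term.realize_restrictVarLeft id (by simp [p])]; rfl
  have et (x : M) : t'.realize (Sum.elim p fun _ => x) = h x := by
    rw [ht', Term.realize_restrictVarLeft id (by simp [p])]; rfl
  have key := realize_of_mem_axioms (.pind (eq s' t') ?_) p
  · have aux (φ : pvLang.Formula (Fin n ⊕ Fin 1)) (f : Fin n ⊕ Fin 1 → pvLang.Term (Fin n ⊕ Fin 1))
        (a : Fin n ⊕ Fin 1 → M) :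
        Formula.Realize (φ.subst f) a ↔ φ.Realize fun b => (f b).realize a :=
      BoundedFormula.realize_subst
    have aux' (φ : pvLang.Formula (Fin n ⊕ Fin 1)) (f : Fin n ⊕ Fin 1 → pvLang.Term (Fin n))
        (a : Fin n → M) :
        Formula.Realize (φ.subst f) a ↔ φ.Realize fun b => (f b).realize a :=
      BoundedFormula.realize_subst
    have e0 : (fun b : Fin n ⊕ Fin 1 => ((Sum.elim Term.var fun _ => zero :
        Fin n ⊕ Fin 1 → pvLang.Term (Fin n)) b).realize p) = Sum.elim p fun _ => 0 := by
      funext b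
      rcases b with b | b
      · rfl
      · exact realize_zero p
    have e1 (i : Fin 1 → M) : (fun b : Fin n ⊕ Fin 1 =>
        ((Sum.elim (fun i => Term.var (Sum.inl i)) fun j => half (Term.var (Sum.inr j)) :
        Fin n ⊕ Fin 1 → pvLang.Term (Fin n ⊕ Fin 1)) b).realize (Sum.elim p i)) =
          Sum.elim p fun _ => hf (i 0) := by
      funext b
      rcases b with b | b
      · rfl
      · simp only [Sum.elim_inr, realize_half]
        rw [Subsingleton.elim b 0]; rfl
    have e2 (i : Fin 1 → M) : (fun b => Sum.elim p i b) = Sum.elim p fun _ => i 0 := by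
      funext b
      rcases b with b | b
      · rfl
      · rw [Subsingleton.elim b 0]; rfl
    simp only [pind, Formula.realize_imp, Formula.realize_iAlls, aux, aux', e0, e1, e2, realize_eq,
      es, et, ← hP] at key
    exact key h0 (fun i => hs (i 0)) fun _ => y
  · exact (BoundedFormula.IsAtomic.equal _ _).isQF

end Axioms

/-! ### Models of `PV₁` as ordered semirings -/

section Semiring

variable {M : Type} [pvLang.Structure M] [hM : M ⊨ PV1]

theorem S_ne (x : M) : x ≠ S x := by
  have := realize_basic .b2 ![x, x, x, x]
  simp only [realize_ne, realize_succ, realize_var] at this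
  exact this

theorem nonneg' (x : M) : 0 ≤ x := by
  have := realize_basic .b3 ![x, x, x, x]
  simp only [realize_le, realize_zero, realize_var] at this
  exact this

theorem le_and_ne_iff (x y : M) : x ≤ y ∧ x ≠ y ↔ S x ≤ y := by
  have := realize_basic .b4 ![x, y, x, x]
  simp only [Formula.realize_iff, Formula.realize_inf, realize_le, realize_ne, realize_succ,
    realize_var] at this
  exact this

theorem le_total' (x y : M) : x ≤ y ∨ y ≤ x := by
  have := realize_basic .b6 ![y, x, x, x]
  simp only [realize_sup, realize_le, realize_var] at this
  exact this

theorem le_antisymm' (x y : M) (h : x ≤ y) (h' : y ≤ x) : x = y := by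
  have := realize_basic .b7 ![x, y, x, x]
  simp only [Formula.realize_imp, Formula.realize_inf, realize_le, realize_eq, realize_var] at this
  exact this ⟨h, h'⟩

theorem le_trans' (x y z : M) (h : x ≤ y) (h' : y ≤ z) : x ≤ z := by
  have := realize_basic .b8 ![x, y, z, x]
  simp only [Formula.realize_imp, Formula.realize_inf, realize_le, realize_var] at this
  exact this ⟨h, h'⟩

theorem add_comm' (x y : M) : x + y = y + x := by
  have := realize_basic .b21 ![x, y, x, x]
  simp only [realize_eq, realize_add, realize_var] at this
  exact this

theorem add_zero' (x : M) : x + 0 = x := by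
  have := realize_basic .b22 ![x, x, x, x]
  simp only [realize_eq, realize_add, realize_zero, realize_var] at this
  exact this

theorem add_S (x y : M) : x + S y = S (x + y) := by
  have := realize_basic .b23 ![x, y, x, x]
  simp only [realize_eq, realize_add, realize_succ, realize_var] at this
  exact this

theorem add_assoc' (x y z : M) : x + y + z = x + (y + z) := by
  have := realize_basic .b24 ![x, y, z, x]
  simp only [realize_eq, realize_add, realize_var] at this
  exact this

theorem add_le_add_left_iff' (x y z : M) : x + y ≤ x + z ↔ y ≤ z := by
  have := realize_basic .b25 ![x, y, z, x]
  simp only [Formula.realize_iff, realize_le, realize_add, realize_var] at this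
  exact this

theorem mul_zero' (x : M) : x * 0 = 0 := by
  have := realize_basic .b26 ![x, x, x, x]
  simp only [realize_eq, realize_mul, realize_zero, realize_var] at this
  exact this

theorem mul_S (x y : M) : x * S y = x * y + x := by
  have := realize_basic .b27 ![x, y, x, x]
  simp only [realize_eq, realize_mul, realize_add, realize_succ, realize_var] at this
  exact this

theorem mul_comm' (x y : M) : x * y = y * x := by
  have := realize_basic .b28 ![x, y, x, x]
  simp only [realize_eq, realize_mul, realize_var] at this
  exact this

theorem mul_add' (x y z : M) : x * (y + z) = x * y + x * z := by
  have := realize_basic .b29 ![x, y, z, x]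
  simp only [realize_eq, realize_mul, realize_add, realize_var] at this
  exact this

theorem mul_le_mul_left_iff' (x y z : M) (h : 1 ≤ x) : x * y ≤ x * z ↔ y ≤ z := by
  have := realize_basic .b30 ![x, y, z, x]
  simp only [Formula.realize_imp, Formula.realize_iff, realize_le, realize_mul, realize_one,
    realize_var] at this
  exact this h

theorem S_eq (x : M) : S x = x + 1 := by
  have h : (1 : M) = S 0 := rfl
  rw [h, add_S, add_zero']

theorem mul_one' (x : M) : x * 1 = x := by
  have h : (1 : M) = S 0 := rfl
  rw [h, mul_S, mul_zero', add_comm', add_zero']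

theorem S_one_mul (x : M) : S 1 * x = x + x := by
  rw [mul_comm', mul_S, mul_one']

theorem eq_hf_iff (x y : M) : x = hf y ↔ x + x = y ∨ x + x + 1 = y := by
  have := realize_basic .b32 ![x, y, x, x]
  simp only [Formula.realize_iff, realize_sup, realize_eq, realize_half, realize_dbl,
    realize_succ, realize_var, S_one_mul] at this
  rwa [← S_eq]

theorem hf_cases (x : M) : hf x + hf x = x ∨ hf x + hf x + 1 = x := (eq_hf_iff _ x).1 rfl

theorem hf_add_self (x : M) : hf (x + x) = x := ((eq_hf_iff _ _).2 (.inl rfl)).symm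

theorem hf_add_self_add_one (x : M) : hf (x + x + 1) = x :=
  ((eq_hf_iff _ _).2 (.inr rfl)).symm

/-- Associativity of multiplication is not among the BASIC axioms. Distributivity reduces it from z
to ⌊z/2⌋. -/
theorem mul_assoc' (x y z : M) : x * y * z = x * (y * z) := by
  refine half_induction (P := fun z => x * y * z = x * (y * z))
    (.of_eq (.mul (.const _) .id) (.mul (.const _) (.mul (.const _) .id))) ?_ ?_ z
  · simp only [mul_zero']
  · intro z h
    rcases hf_cases z with hz | hz
    · rw [← hz, mul_add', mul_add', mul_add', h]
    · rw [← hz]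
      simp only [mul_add', mul_one', h]

instance : CommSemiring M where
  add_assoc := add_assoc'
  zero_add x := by rw [add_comm', add_zero']
  add_zero := add_zero'
  add_comm := add_comm'
  mul_assoc := mul_assoc'
  one_mul x := by rw [mul_comm', mul_one']
  mul_one := mul_one'
  zero_mul x := by rw [mul_comm', mul_zero']
  mul_zero := mul_zero'
  mul_comm := mul_comm'
  left_distrib := mul_add'
  right_distrib x y z := by rw [mul_comm', mul_add', mul_comm' z x, mul_comm' z y]
  nsmul := nsmulRec

noncomputable instance : LinearOrder M where
  le_refl x := (le_total' x x).elim id id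
  le_trans := le_trans'
  le_antisymm := le_antisymm'
  le_total := le_total'
  toDecidableLE := Classical.decRel _

theorem lt_iff {x y : M} : x < y ↔ x + 1 ≤ y := by
  rw [← S_eq, ← le_and_ne_iff, lt_iff_le_and_ne]

theorem lt_add_one' (x : M) : x < x + 1 := lt_iff.2 le_rfl

theorem lt_add_one_iff' {x y : M} : x < y + 1 ↔ x ≤ y := by
  rw [lt_iff, add_comm x, add_comm y]
  exact add_le_add_left_iff' _ _ _

theorem one_le_iff {x : M} : 1 ≤ x ↔ x ≠ 0 := by
  rw [← zero_add (1 : M), ← lt_iff, lt_iff_le_and_ne]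
  exact ⟨fun h => h.2.symm, fun h => ⟨nonneg' x, h.symm⟩⟩

instance : IsOrderedCancelAddMonoid M where
  add_le_add_left x y h z := by
    rw [add_comm x, add_comm y]
    exact (add_le_add_left_iff' _ _ _).2 h
  le_of_add_le_add_left x y z h := (add_le_add_left_iff' _ _ _).1 h

instance : IsStrictOrderedRing M where
  zero_le_one := nonneg' _
  exists_pair_ne := ⟨0, 1, by simpa only [S_eq, zero_add] using S_ne (0 : M)⟩
  mul_lt_mul_of_pos_left x hx y z h := by
    have hx : 1 ≤ x := by rwa [lt_iff, zero_add] at hx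
    rw [← not_le] at h ⊢
    rwa [mul_le_mul_left_iff' _ _ _ hx]
  mul_lt_mul_of_pos_right x hx y z h := by
    have hx : 1 ≤ x := by rwa [lt_iff, zero_add] at hx
    rw [← not_le] at h ⊢
    rwa [mul_comm' z, mul_comm' y, mul_le_mul_left_iff' _ _ _ hx]

theorem zero_le' (x : M) : 0 ≤ x := nonneg' x

theorem mul_left_cancel_of_ne_zero {x y z : M} (hx : x ≠ 0) (h : x * y = x * z) : y = z :=
  le_antisymm ((mul_le_mul_left_iff' x y z (one_le_iff.2 hx)).1 h.le)
    ((mul_le_mul_left_iff' x z y (one_le_iff.2 hx)).1 h.ge)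

theorem double_ne_zero {x : M} : x + x ≠ 0 ↔ x ≠ 0 := by
  constructor
  · rintro h rfl
    exact h (add_zero 0)
  · intro h
    have := one_le_iff.2 h
    have := zero_lt_one (α := M)
    grind

theorem add_one_ne_zero (x : M) : x + 1 ≠ 0 := by
  have := zero_le' x
  have := zero_lt_one (α := M)
  grind

end Semiring

/-! ### Open predicates -/

section OpenPred

variable {M : Type} [pvLang.Structure M] [hM : M ⊨ PV1]

theorem lq_of_not_le {x y : M} (h : ¬x ≤ y) : lq x y = 0 := by
  have := realize_of_mem_axioms .leq_char ![x, y]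
  simp only [realize_sup, realize_eq, realize_leq, realize_zero, realize_one, realize_var] at this
  exact this.resolve_right h

open Classical in
theorem lq_eq (x y : M) : lq x y = if x ≤ y then 1 else 0 := by
  split_ifs with h
  exacts [lq_eq_one.2 h, lq_of_not_le h]

open Classical in
/-- A predicate on a model whose characteristic function is given by a term with parameters. -/
def OpenPred (P : M → Prop) : Prop :=
  ∃ g : M → M, TermFun g ∧ ∀ x, g x = if P x then 1 else 0

theorem OpenPred.le {g h : M → M} (hg : TermFun g) (hh : TermFun h) :
    OpenPred fun x => g x ≤ h x :=
  ⟨_, hg.lq hh, fun _ => lq_eq _ _⟩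

theorem OpenPred.not {P : M → Prop} (hP : OpenPred P) : OpenPred fun x => ¬P x := by
  obtain ⟨g, hg, e⟩ := hP
  -- The truth value of g ≤ 0 is the negation of the truth value g.
  refine ⟨_, hg.lq (.const 0), fun x => ?_⟩
  have h : ¬(1 : M) ≤ 0 := not_le.2 zero_lt_one
  by_cases hx : P x <;> simp [lq_eq, e, hx, h]

theorem OpenPred.and {P Q : M → Prop} (hP : OpenPred P) (hQ : OpenPred Q) :
    OpenPred fun x => P x ∧ Q x := by
  obtain ⟨g, hg, e⟩ := hP
  obtain ⟨h, hh, e'⟩ := hQ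
  refine ⟨_, hg.mul hh, fun x => ?_⟩
  by_cases hx : P x <;> by_cases hx' : Q x <;> simp [e, e', hx, hx']

theorem OpenPred.imp {P Q : M → Prop} (hP : OpenPred P) (hQ : OpenPred Q) :
    OpenPred fun x => P x → Q x := by
  simpa only [not_and, not_not] using (hP.and hQ.not).not

theorem OpenPred.eq {g h : M → M} (hg : TermFun g) (hh : TermFun h) :
    OpenPred fun x => g x = h x := by
  simpa only [← le_antisymm_iff] using (OpenPred.le hg hh).and (.le hh hg)

theorem OpenPred.lt {g h : M → M} (hg : TermFun g) (hh : TermFun h) :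
    OpenPred fun x => g x < h x := by
  simpa only [not_le] using (OpenPred.le hh hg).not

/-- An open predicate is the equation χ = 1 for its characteristic term χ, so induction for
equations suffices. -/
theorem OpenPred.half_induction {P : M → Prop} (hP : OpenPred P) (h0 : P 0)
    (hs : ∀ y, P (hf y) → P y) (y : M) : P y := by
  obtain ⟨g, hg, e⟩ := hP
  refine PV.half_induction ⟨g, fun _ => 1, hg, .const 1, fun x => ?_⟩ h0 hs y
  by_cases h : P x <;> simp [e, h]

/-- Induction on the binary representation. -/
theorem OpenPred.induction {P : M → Prop} (hP : OpenPred P) (h0 : P 0)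
    (he : ∀ y, y ≠ 0 → P y → P (y + y)) (ho : ∀ y, P y → P (y + y + 1)) (y : M) : P y := by
  refine hP.half_induction h0 (fun y h => ?_) y
  rcases hf_cases y with e | e
  · by_cases hy : hf y = 0
    · rw [hy, add_zero] at e
      rwa [← e]
    · simpa only [e] using he _ hy h
  · simpa only [e] using ho _ h

/-- Only a case distinction, so no definability of `P` is required. It yields the bounds that
limited recursion imposes through its limiting term. -/
theorem binary_cases {P : M → Prop} (h0 : P 0) (he : ∀ y, y ≠ 0 → P (y + y))
    (ho : ∀ y, P (y + y + 1)) (y : M) : P y := by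
  rcases hf_cases y with e | e
  · by_cases hy : hf y = 0
    · rw [hy, add_zero] at e
      rwa [← e]
    · exact e ▸ he _ hy
  · exact e ▸ ho _

end OpenPred

/-! ### Defining equations -/

section Ev

variable {M : Type} [pvLang.Structure M]

theorem ev_cons {m n : ℕ} (F : PVFun n) (G : Fin m → PVFun n) (a : Fin n → M) :
    (fun i => ev (Matrix.vecCons F G i) a) = Matrix.vecCons (ev F a) fun i => ev (G i) a := by
  funext i
  cases i using Fin.cases <;> rfl

theorem ev_nil {n : ℕ} (G : Fin 0 → PVFun n) (a : Fin n → M) : (fun i => ev (G i) a) = ![] :=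
  Subsingleton.elim _ _

variable [hM : M ⊨ PV1]

theorem ev_proj {n : ℕ} (i : Fin n) (a : Fin n → M) : ev (.proj i) a = a i := by
  have := realize_of_mem_axioms (.proj i) a
  rwa [realize_eq, realize_app] at this

theorem ev_comp {m n : ℕ} (F : PVFun m) (G : Fin m → PVFun n) (a : Fin n → M) :
    ev (.comp F G) a = ev F fun i => ev (G i) a := by
  have := realize_of_mem_axioms (.comp F G) a
  rwa [realize_eq, realize_app, realize_app] at this

variable {n : ℕ} (F G : PVFun n) (a : Fin n → M)

theorem ev_zeroF : ev zeroF a = 0 := by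
  rw [zeroF, ev_comp, ev_nil]; rfl

theorem ev_succF : ev (succF F) a = ev F a + 1 := by
  rw [succF, ev_comp, ev_cons, ev_nil, ← S_eq]; rfl

theorem ev_addF : ev (addF F G) a = ev F a + ev G a := by
  rw [addF, ev_comp, ev_cons, ev_cons, ev_nil]; rfl

theorem ev_mulF : ev (mulF F G) a = ev F a * ev G a := by
  rw [mulF, ev_comp, ev_cons, ev_cons, ev_nil]; rfl

theorem ev_smashF : ev (smashF F G) a = sm (ev F a) (ev G a) := by
  rw [smashF, ev_comp, ev_cons, ev_cons, ev_nil]; rfl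

theorem ev_halfF : ev (halfF F) a = hf (ev F a) := by
  rw [halfF, ev_comp, ev_cons, ev_nil]; rfl

theorem ev_lenF : ev (lenF F) a = ln (ev F a) := by
  rw [lenF, ev_comp, ev_cons, ev_nil]; rfl

theorem ev_leqF : ev (leqF F G) a = lq (ev F a) (ev G a) := by
  rw [leqF, ev_comp, ev_cons, ev_cons, ev_nil]; rfl

theorem ev_dblF : ev (dblF F) a = ev F a + ev F a := by
  rw [dblF, ev_mulF, ev_succF, ev_succF, ev_zeroF]
  ring

variable (g : PVFun n) (h₀ h₁ : PVFun (n + 2)) (k : PVFun (n + 1))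

theorem ev_lrn_zero : ev (.lrn g h₀ h₁ k) (Matrix.vecCons 0 a) = ev g a := by
  have := realize_of_mem_axioms (.lrn_zero g h₀ h₁ k) a
  rw [realize_eq, realize_app, realize_app, realize_cons, realize_zero] at this
  exact this

theorem realize_isMin {α : Type} (a : α → M) (t₀ t₁ t₂ : pvLang.Term α) :
    (isMin t₀ t₁ t₂).Realize a ↔ t₀.realize a = min (t₁.realize a) (t₂.realize a) := by
  simp only [isMin, Formula.realize_inf, Formula.realize_imp, Formula.realize_not, realize_le,
    realize_eq]
  by_cases h : t₁.realize a ≤ t₂.realize a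
  · simp [h]
  · simp [h, min_eq_right (le_of_not_ge h)]

theorem ev_lrn_even {y : M} (hy : y ≠ 0) :
    ev (.lrn g h₀ h₁ k) (Matrix.vecCons (y + y) a) =
      min (ev h₀ (Matrix.vecCons y
        (Matrix.vecCons (ev (.lrn g h₀ h₁ k) (Matrix.vecCons y a)) a)))
        (ev k (Matrix.vecCons (y + y) a)) := by
  have := realize_of_mem_axioms (.lrn_even g h₀ h₁ k) (Matrix.vecCons y a)
  simp only [Formula.realize_imp, realize_ne, realize_zero, realize_isMin, realize_app,
    realize_cons, realize_dbl, S_one_mul, realize_var, Matrix.cons_val_zero,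
    Matrix.cons_val_succ, double_ne_zero] at this
  exact this hy

theorem ev_lrn_odd (y : M) :
    ev (.lrn g h₀ h₁ k) (Matrix.vecCons (y + y + 1) a) =
      min (ev h₁ (Matrix.vecCons y
        (Matrix.vecCons (ev (.lrn g h₀ h₁ k) (Matrix.vecCons y a)) a)))
        (ev k (Matrix.vecCons (y + y + 1) a)) := by
  have := realize_of_mem_axioms (.lrn_odd g h₀ h₁ k) (Matrix.vecCons y a)
  simp only [realize_isMin, realize_app, realize_cons, realize_succ, realize_dbl, S_one_mul,
    realize_var, Matrix.cons_val_zero, Matrix.cons_val_succ] at this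
  rwa [S_eq] at this

end Ev

/-! ### Length and smash -/

section Length

variable {M : Type} [pvLang.Structure M] [hM : M ⊨ PV1]

theorem ln_zero : ln (0 : M) = 0 := by
  have := realize_basic .b9 (0 : Fin 4 → M)
  simpa only [realize_eq, realize_len, realize_zero] using this

theorem ln_one : ln (1 : M) = 1 := by
  have := realize_basic .b11 (0 : Fin 4 → M)
  simpa only [realize_eq, realize_len, realize_one] using this

theorem ln_double {x : M} (hx : x ≠ 0) : ln (x + x) = ln x + 1 := by
  have := realize_basic .b10 ![x, x, x, x]
  simp only [Formula.realize_imp, Formula.realize_inf, realize_ne, realize_zero, realize_eq,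
    realize_len, realize_succ, realize_dbl, S_one_mul, realize_var] at this
  rw [← S_eq]
  exact (this hx).1

theorem ln_double_add_one (x : M) : ln (x + x + 1) = ln x + 1 := by
  by_cases hx : x = 0
  · rw [hx, add_zero, zero_add, ln_zero, ln_one, zero_add]
  · have := realize_basic .b10 ![x, x, x, x]
    simp only [Formula.realize_imp, Formula.realize_inf, realize_ne, realize_zero, realize_eq,
      realize_len, realize_succ, realize_dbl, S_one_mul, realize_var] at this
    rw [← S_eq, ← S_eq]
    exact (this hx).2

theorem ln_mono {x y : M} (h : x ≤ y) : ln x ≤ ln y := by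
  have := realize_basic .b12 ![x, y, x, x]
  simp only [Formula.realize_imp, realize_le, realize_len, realize_var] at this
  exact this h

theorem ln_eq_zero {x : M} : ln x = 0 ↔ x = 0 := by
  refine ⟨fun h => ?_, fun h => h ▸ ln_zero⟩
  by_contra hx
  have := ln_mono (one_le_iff.2 hx)
  rw [ln_one, h] at this
  exact not_lt.2 this zero_lt_one

theorem ln_hf {x : M} (hx : x ≠ 0) : ln (hf x) + 1 = ln x := by
  have := realize_basic .b31 ![x, x, x, x]
  simp only [Formula.realize_imp, realize_ne, realize_zero, realize_eq, realize_len, realize_succ,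
    realize_half, realize_var] at this
  rw [← S_eq]
  exact (this hx).symm

theorem hf_zero : hf (0 : M) = 0 := by
  simpa only [add_zero] using hf_add_self (0 : M)

theorem hf_le (x : M) : hf x ≤ x := by
  have := zero_le' (hf x)
  have := zero_lt_one (α := M)
  rcases hf_cases x with h | h <;> grind

theorem ln_sm (x y : M) : ln (sm x y) = ln x * ln y + 1 := by
  have := realize_basic .b13 ![x, y, x, x]
  simp only [realize_eq, realize_len, realize_smash, realize_succ, realize_mul, realize_var] at this
  rw [← S_eq]
  exact this

theorem zero_sm (x : M) : sm 0 x = 1 := by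
  have := realize_basic .b14 ![x, x, x, x]
  simp only [realize_eq, realize_smash, realize_zero, realize_one, realize_var] at this
  exact this

theorem sm_comm (x y : M) : sm x y = sm y x := by
  have := realize_basic .b16 ![x, y, x, x]
  simp only [realize_eq, realize_smash, realize_var] at this
  exact this

theorem sm_congr_left {x y : M} (h : ln x = ln y) (z : M) : sm x z = sm y z := by
  have := realize_basic .b17 ![x, y, z, x]
  simp only [Formula.realize_imp, realize_eq, realize_len, realize_smash, realize_var] at this
  exact this h

theorem sm_of_ln_add {x y z : M} (h : ln x = ln y + ln z) (t : M) :
    sm x t = sm y t * sm z t := by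
  have := realize_basic .b18 ![x, y, z, t]
  simp only [Formula.realize_imp, realize_eq, realize_len, realize_smash, realize_add,
    realize_mul, realize_var] at this
  exact this h

theorem one_sm_zero : sm (1 : M) 0 = 1 := by rw [sm_comm, zero_sm]

/-- The BASIC axioms on 1 # 2x exclude x = 0, so this value has to be deduced: 1 # 2 equals both 2 ·
(1 # 1) and, since |2| = |1| + |1|, the square of 1 # 1. The factor 1 # 1 cancels because its length
is a successor. -/
theorem one_sm_one : sm (1 : M) 1 = 1 + 1 := by
  have h := realize_basic .b15 ![(1 : M), 1, 1, 1]
  simp only [Formula.realize_imp, Formula.realize_inf, realize_ne, realize_zero, realize_eq,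
    realize_smash, realize_one, realize_succ, realize_dbl, S_one_mul, realize_var] at h
  have h1 : sm (1 : M) (1 + 1) = sm 1 1 + sm 1 1 := (h one_ne_zero).1
  rw [sm_comm, sm_of_ln_add (y := 1) (z := 1) (by rw [ln_double one_ne_zero, ln_one])] at h1
  have h2 : sm (1 : M) 1 ≠ 0 := by
    intro e
    have := ln_sm (1 : M) 1
    rw [e, ln_zero] at this
    exact add_one_ne_zero _ this.symm
  have h3 : sm (1 : M) 1 * sm 1 1 = sm 1 1 * (1 + 1) := by rw [h1]; ring
  exact mul_left_cancel_of_ne_zero h2 h3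

/-- Together with `one_sm_zero` and `one_sm_double_add_one`, this lets `sm 1 x` serve as 2 ^ |x|. -/
theorem one_sm_double {x : M} (hx : x ≠ 0) : sm 1 (x + x) = sm 1 x + sm 1 x := by
  have h := realize_basic .b15 ![x, x, x, x]
  simp only [Formula.realize_imp, Formula.realize_inf, realize_ne, realize_zero, realize_eq,
    realize_smash, realize_one, realize_succ, realize_dbl, S_one_mul, realize_var] at h
  exact (h hx).1

theorem one_sm_double_add_one (x : M) : sm 1 (x + x + 1) = sm 1 x + sm 1 x := by
  by_cases hx : x = 0
  · rw [hx, add_zero, zero_add, one_sm_zero, one_sm_one]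
  · rw [← one_sm_double hx, sm_comm 1, sm_comm 1,
      sm_congr_left (by rw [ln_double hx, ln_double_add_one])]

theorem ln_add_one_le_one_sm (x : M) : ln x + 1 ≤ sm 1 x := by
  refine OpenPred.induction (P := fun x => ln x + 1 ≤ sm 1 x)
    (.le (.add (.ln .id) (.const _)) (.sm (.const _) .id)) ?_ ?_ ?_ x
  · rw [ln_zero, one_sm_zero, zero_add]
  · intro y hy h
    rw [ln_double hy, one_sm_double hy]
    have := zero_le' (ln y)
    grind
  · intro y h
    rw [ln_double_add_one, one_sm_double_add_one]
    have := zero_le' (ln y)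
    grind

end Length

/-! ### Particular functions in a model -/

section Functions

variable {M : Type} [pvLang.Structure M]

/-- The number of binary ones in a model. -/
def no (x : M) : M := ev numOnes ![x]

/-- The factorial of the length in a model. -/
def fc (x : M) : M := ev fact ![x]

/-- Integer division in a model. -/
def dv (x d : M) : M := ev div ![x, d]

/-- The value `⌊x / 2 ^ |u|⌋` in a model. -/
def sh (u x : M) : M := ev shift ![u, x]

/-- The binomial coefficient of the lengths in a model. -/
def bn (w u : M) : M := ev binom ![w, u]

theorem TermFun.no {g : M → M} (hg : TermFun g) : TermFun fun x => no (g x) :=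
  hg.ev_one numOnes

theorem TermFun.fc {g : M → M} (hg : TermFun g) : TermFun fun x => fc (g x) :=
  hg.ev_one fact

theorem TermFun.dv {g h : M → M} (hg : TermFun g) (hh : TermFun h) :
    TermFun fun x => dv (g x) (h x) := hg.ev_two div hh

theorem TermFun.sh {g h : M → M} (hg : TermFun g) (hh : TermFun h) :
    TermFun fun x => sh (g x) (h x) := hg.ev_two shift hh

theorem TermFun.bn {g h : M → M} (hg : TermFun g) (hh : TermFun h) :
    TermFun fun x => bn (g x) (h x) := hg.ev_two binom hh

/-- The number `x` has only ones in its binary representation. -/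
def Unary (x : M) : Prop := no x = ln x

variable [hM : M ⊨ PV1]

theorem OpenPred.unary {g : M → M} (hg : TermFun g) : OpenPred fun x => Unary (g x) :=
  .eq hg.no hg.ln

/-! ### The number of ones. -/

theorem no_zero : no (0 : M) = 0 := by
  rw [no, numOnes, ev_lrn_zero, ev_zeroF]

/-- The bound comes from the limiting term alone. Once known, it shows that the minimum in the
recursion is attained by the recursive clause, which gives the intended equations. The lemmas
`sh_le`, `fc_le`, `sl_le` and `rk_le` have the same purpose. -/
theorem no_le (x : M) : no x ≤ x := by
  refine binary_cases (P := fun x => no x ≤ x) ?_ ?_ ?_ x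
  · rw [no_zero]
  · intro y hy
    rw [no, numOnes, ev_lrn_even _ _ _ _ _ hy]
    exact (min_le_right _ _).trans_eq (ev_proj _ _)
  · intro y
    rw [no, numOnes, ev_lrn_odd]
    exact (min_le_right _ _).trans_eq (ev_proj _ _)

theorem no_double (x : M) : no (x + x) = no x := by
  by_cases hx : x = 0
  · rw [hx, add_zero]
  · rw [no, numOnes, ev_lrn_even _ _ _ _ _ hx, ev_proj, ev_proj]
    refine min_eq_left ((no_le x).trans ?_)
    exact le_add_of_nonneg_left (zero_le' x)

theorem no_double_add_one (x : M) : no (x + x + 1) = no x + 1 := by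
  rw [no, numOnes, ev_lrn_odd, ev_succF, ev_proj, ev_proj]
  refine min_eq_left (add_le_add_left ((no_le x).trans ?_) 1)
  exact le_add_of_nonneg_left (zero_le' x)

theorem no_le_ln (x : M) : no x ≤ ln x := by
  refine OpenPred.induction (P := fun x => no x ≤ ln x) (.le (.no .id) (.ln .id)) ?_ ?_ ?_ x
  · rw [no_zero, ln_zero]
  · intro y hy h
    rw [no_double, ln_double hy]
    exact h.trans (lt_add_one' _).le
  · intro y h
    rw [no_double_add_one, ln_double_add_one]
    exact add_le_add_left h 1

/-! ### Numbers in unary. -/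

theorem unary_zero : Unary (0 : M) := no_zero.trans ln_zero.symm

theorem unary_double_add_one {x : M} : Unary (x + x + 1) ↔ Unary x := by
  rw [Unary, no_double_add_one, ln_double_add_one, Unary]
  exact add_left_inj 1

theorem not_unary_double {x : M} (hx : x ≠ 0) : ¬Unary (x + x) := by
  rw [Unary, no_double, ln_double hx]
  exact ((no_le_ln x).trans_lt (lt_add_one' _)).ne

theorem Unary.eq_zero_or {x : M} (hx : Unary x) : x = 0 ∨ ∃ y, Unary y ∧ x = y + y + 1 := by
  revert hx
  refine binary_cases (P := fun x => Unary x → x = 0 ∨ ∃ y, Unary y ∧ x = y + y + 1) ?_ ?_ ?_ x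
  · exact fun _ => .inl rfl
  · exact fun y hy h => (not_unary_double hy h).elim
  · exact fun y h => .inr ⟨y, unary_double_add_one.1 h, rfl⟩

theorem Unary.hf {x : M} (hx : Unary x) : Unary (hf x) := by
  obtain rfl | ⟨y, hy, rfl⟩ := hx.eq_zero_or
  · rwa [hf_zero]
  · rwa [hf_add_self_add_one]

theorem Unary.add_one {x : M} (hx : Unary x) : x + 1 = sm 1 x := by
  revert hx
  refine OpenPred.induction (P := fun x => Unary x → x + 1 = sm 1 x)
    (.imp (.unary .id) (.eq (.add .id (.const _)) (.sm (.const _) .id))) ?_ ?_ ?_ x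
  · intro
    rw [zero_add, one_sm_zero]
  · exact fun y hy _ h => (not_unary_double hy h).elim
  · intro y ih h
    rw [one_sm_double_add_one, ← ih (unary_double_add_one.1 h)]
    ring

/-- The number 1^(k) is 2 ^ k - 1, and 2 ^ k = `sm 1 x` depends only on the length. -/
theorem Unary.ext {x y : M} (hx : Unary x) (hy : Unary y) (h : ln x = ln y) : x = y := by
  have : x + 1 = y + 1 := by
    rw [hx.add_one, hy.add_one, sm_comm, sm_congr_left h, sm_comm]
  exact add_right_cancel this

/-! ### Shifts, which subtract numbers in unary. -/

theorem zero_sh (x : M) : sh 0 x = x := by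
  rw [sh, shift, ev_lrn_zero, ev_proj]; rfl

theorem sh_le (u x : M) : sh u x ≤ x := by
  refine binary_cases (P := fun u => sh u x ≤ x) ?_ ?_ ?_ u
  · rw [zero_sh]
  · intro y hy
    rw [sh, shift, ev_lrn_even _ _ _ _ _ hy]
    exact (min_le_right _ _).trans_eq (ev_proj _ _)
  · intro y
    rw [sh, shift, ev_lrn_odd]
    exact (min_le_right _ _).trans_eq (ev_proj _ _)

theorem double_sh {u : M} (hu : u ≠ 0) (x : M) : sh (u + u) x = hf (sh u x) := by
  rw [sh, shift, ev_lrn_even _ _ _ _ _ hu, ev_halfF, ev_proj, ev_proj]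
  exact min_eq_left ((hf_le _).trans (sh_le u x))

theorem double_add_one_sh (u x : M) : sh (u + u + 1) x = hf (sh u x) := by
  rw [sh, shift, ev_lrn_odd, ev_halfF, ev_proj, ev_proj]
  exact min_eq_left ((hf_le _).trans (sh_le u x))

theorem Unary.sh {x : M} (hx : Unary x) (u : M) : Unary (sh u x) := by
  refine OpenPred.induction (P := fun u => Unary (PV.sh u x)) (.unary (.sh .id (.const _)))
    ?_ ?_ ?_ u
  · rwa [zero_sh]
  · intro y hy h
    rw [double_sh hy]
    exact h.hf
  · intro y h
    rw [double_add_one_sh]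
    exact h.hf

theorem ln_sh {u x : M} (h : ln u ≤ ln x) : ln (sh u x) + ln u = ln x := by
  revert h
  have step {u : M} (ih : ln u ≤ ln x → ln (sh u x) + ln u = ln x) (h : ln u + 1 ≤ ln x) :
      ln (hf (sh u x)) + (ln u + 1) = ln x := by
    have h' := ih ((lt_add_one' _).le.trans h)
    have : sh u x ≠ 0 := by
      intro e
      rw [e, ln_zero, zero_add] at h'
      exact not_lt.2 h (h' ▸ lt_add_one' _)
    rw [← h', ← ln_hf this]
    ring
  refine OpenPred.induction (P := fun u => ln u ≤ ln x → ln (sh u x) + ln u = ln x)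
    (.imp (.le (.ln .id) (.const _)) (.eq (.add (.ln (.sh .id (.const _))) (.ln .id)) (.const _)))
    ?_ ?_ ?_ u
  · intro
    rw [zero_sh, ln_zero, add_zero]
  · intro u hu ih h
    rw [ln_double hu] at h ⊢
    rw [double_sh hu]
    exact step ih h
  · intro u ih h
    rw [ln_double_add_one] at h ⊢
    rw [double_add_one_sh]
    exact step ih h

theorem Unary.sh_eq {u v w : M} (hv : Unary v) (hw : Unary w) (h : ln v + ln u = ln w) :
    PV.sh u w = v := by
  refine (hw.sh u).ext hv ?_
  have := ln_sh (u := u) (x := w) (h ▸ le_add_of_nonneg_left (zero_le' _))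
  rw [← h] at this
  exact add_right_cancel this

/-! ### Division with remainder. -/

theorem zero_dv (d : M) : dv 0 d = 0 := by
  rw [dv, div, ev_lrn_zero, ev_zeroF]

theorem dv_spec {d : M} (hd : d ≠ 0) (x : M) : d * dv x d ≤ x ∧ x < d * (dv x d + 1) := by
  have hd1 : 1 ≤ d := one_le_iff.2 hd
  -- Here c is the digit appended to y. Both recursive clauses have this form, and the inequalities
  -- q ≤ d q and 2q + 1 ≤ d (2q + 1) show that the limiting term has no effect.
  have step (c y q : M) (hc : c ≤ 1) (hc0 : 0 ≤ c) (h : d * q ≤ y ∧ y < d * (q + 1)) :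
      let q' := min (q + q + lq (d * (q + q + 1)) (y + y + c)) (y + y + c)
      d * q' ≤ y + y + c ∧ y + y + c < d * (q' + 1) := by
    intro q'
    obtain ⟨h1, h2⟩ := h
    have hq : q ≤ d * q := le_mul_of_one_le_left (zero_le' q) hd1
    rw [lt_iff] at h2
    have e1 : d * (q + 1) = d * q + d := by ring
    have e2 : d * (q + q) = d * q + d * q := by ring
    have e3 : d * (q + q + 1) = d * q + d * q + d := by ring
    have e4 : d * (q + q + 1 + 1) = d * q + d * q + d + d := by ring
    have key : q + q + lq (d * (q + q + 1)) (y + y + c) ≤ y + y + c ∧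
        d * (q + q + lq (d * (q + q + 1)) (y + y + c)) ≤ y + y + c ∧
        y + y + c < d * (q + q + lq (d * (q + q + 1)) (y + y + c) + 1) := by
      have := zero_lt_one (α := M)
      rw [lq_eq]
      split_ifs with h3
      · have h4 : q + q + 1 ≤ d * (q + q + 1) :=
          le_mul_of_one_le_left (zero_le' _) hd1
        refine ⟨h4.trans h3, h3, ?_⟩
        rw [e4]
        grind
      · rw [add_zero, e2]
        grind
    have e : q' = q + q + lq (d * (q + q + 1)) (y + y + c) := min_eq_left key.1
    rw [e]
    exact key.2
  refine OpenPred.induction (P := fun x => d * dv x d ≤ x ∧ x < d * (dv x d + 1))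
    (.and (.le (.mul (.const _) (.dv .id (.const _))) .id)
      (.lt .id (.mul (.const _) (.add (.dv .id (.const _)) (.const _))))) ?_ ?_ ?_ x
  · rw [zero_dv, mul_zero, zero_add, mul_one]
    exact ⟨le_rfl, zero_lt_one.trans_le hd1⟩
  · intro y hy h
    have := step 0 y _ zero_le_one le_rfl h
    rw [add_zero] at this
    rw [dv, div, ev_lrn_even _ _ _ _ _ hy]
    simp only [ev_addF, ev_dblF, ev_leqF, ev_mulF, ev_succF, ev_proj]
    exact this
  · intro y h
    have := step 1 y _ le_rfl zero_le_one h
    rw [dv, div, ev_lrn_odd]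
    simp only [ev_addF, ev_dblF, ev_leqF, ev_mulF, ev_succF, ev_proj]
    exact this

theorem dv_mul {d : M} (hd : d ≠ 0) (q : M) : dv (d * q) d = q := by
  obtain ⟨h1, h2⟩ := dv_spec hd (d * q)
  have hd1 : 1 ≤ d := one_le_iff.2 hd
  refine le_antisymm ((mul_le_mul_left_iff' _ _ _ hd1).1 h1) ?_
  rw [← not_le, mul_le_mul_left_iff' _ _ _ hd1, not_le, lt_add_one_iff'] at h2
  exact h2

/-! ### Factorials of lengths. -/

theorem fc_zero : fc (0 : M) = 1 := by
  rw [fc, fact]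
  simp only [ev_lrn_zero, ev_succF, ev_zeroF, zero_add]

theorem fc_le (x : M) : fc x ≤ sm x x := by
  refine binary_cases (P := fun x => fc x ≤ sm x x) ?_ ?_ ?_ x
  · rw [fc_zero, zero_sm]
  · intro y hy
    rw [fc, fact]
    simp only [ev_lrn_even _ _ _ _ _ hy, ev_smashF, ev_proj]
    exact min_le_right _ _
  · intro y
    rw [fc, fact]
    simp only [ev_lrn_odd, ev_smashF, ev_proj]
    exact min_le_right _ _

/-- With n = |y|, the smash terms are powers of two with exponents (n + 1)² = n² + n + (n + 1): the
first part bounds the factorial n!, and 2 ^ n absorbs the factor n + 1. -/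
theorem fc_mul_le {y z : M} (h : ln z = ln y + 1) : fc y * (ln y + 1) ≤ sm z z := by
  rw [← ln_one (M := M)] at h
  have e1 : sm z z = sm y z * sm 1 z := sm_of_ln_add h z
  have e2 : sm z y = sm y y * sm 1 y := sm_of_ln_add h y
  have e3 : sm z 1 = sm y 1 * sm 1 1 := sm_of_ln_add h 1
  have p : ln y + 1 ≤ sm 1 y := ln_add_one_le_one_sm y
  have p2 : 1 ≤ sm (1 : M) z := (le_add_of_nonneg_left (zero_le' _)).trans (ln_add_one_le_one_sm z)
  rw [e1, sm_comm y z, e2]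
  calc fc y * (ln y + 1) ≤ sm y y * sm 1 y :=
        mul_le_mul (fc_le y) p (zero_le' _) (zero_le' _)
    _ ≤ sm y y * sm 1 y * sm 1 z := le_mul_of_one_le_right (zero_le' _) p2

theorem fc_double {y : M} (hy : y ≠ 0) : fc (y + y) = fc y * (ln y + 1) := by
  rw [fc, fact]
  simp only [ev_lrn_even _ _ _ _ _ hy, ev_smashF, ev_mulF, ev_succF, ev_lenF, ev_proj]
  exact min_eq_left (fc_mul_le (ln_double hy))

theorem fc_double_add_one (y : M) : fc (y + y + 1) = fc y * (ln y + 1) := by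
  rw [fc, fact]
  simp only [ev_lrn_odd, ev_smashF, ev_mulF, ev_succF, ev_lenF, ev_proj]
  exact min_eq_left (fc_mul_le (ln_double_add_one y))

theorem mul_ne_zero' {x y : M} (hx : x ≠ 0) (hy : y ≠ 0) : x * y ≠ 0 := fun h =>
  hy (mul_left_cancel_of_ne_zero hx (h.trans (mul_zero x).symm))

theorem fc_ne_zero (x : M) : fc x ≠ 0 := by
  refine OpenPred.induction (P := fun x => fc x ≠ 0) (.not (.eq (.fc .id) (.const _))) ?_ ?_ ?_ x
  · rw [fc_zero]
    exact one_ne_zero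
  · intro y hy h
    rw [fc_double hy]
    exact mul_ne_zero' h (add_one_ne_zero _)
  · intro y h
    rw [fc_double_add_one]
    exact mul_ne_zero' h (add_one_ne_zero _)

theorem bn_eq (w u : M) :
    bn w u = lq (ln u) (ln w) * dv (fc w) (fc u * fc (sh u w)) := by
  rw [bn, binom]
  simp only [ev_mulF, ev_leqF, ev_lenF, ev_proj, ev_comp, ev_cons, ev_nil]
  rfl

end Functions

/-! ### Sharply bounded quantification -/

/-- The characteristic function of the predicate `∀ u, P(shift(u, y), p) ≤ Q(shift(u, y), p)` of
`y` and `p`. -/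
def allLe (P Q : PVFun 2) : PVFun 2 :=
  let step (z : PVFun 3) : PVFun 3 :=
    mulF (.proj 1) (leqF (.comp P ![z, .proj 2]) (.comp Q ![z, .proj 2]))
  .lrn (leqF (.comp P ![zeroF, .proj 0]) (.comp Q ![zeroF, .proj 0]))
    (step (dblF (.proj 0))) (step (succF (dblF (.proj 0)))) (succF zeroF)

section AllLe

variable {M : Type} [pvLang.Structure M] [hM : M ⊨ PV1] (P Q : PVFun 2)

theorem allLe_zero (p : M) : ev (allLe P Q) ![0, p] = 1 ↔ ev P ![0, p] ≤ ev Q ![0, p] := by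
  rw [allLe, ev_lrn_zero]
  simp only [ev_leqF, ev_comp, ev_cons, ev_nil, ev_zeroF, ev_proj]
  exact lq_eq_one

theorem min_mul_lq_eq_one {a x y : M} (ha : a ≤ 1) :
    min (a * lq x y) 1 = 1 ↔ a = 1 ∧ x ≤ y := by
  rw [lq_eq]
  split_ifs with h
  · rw [mul_one, min_eq_left ha]
    simp [h]
  · rw [mul_zero, min_eq_left zero_le_one]
    simp [h]

theorem allLe_le_one (y p : M) : ev (allLe P Q) ![y, p] ≤ 1 := by
  refine binary_cases (P := fun y => ev (allLe P Q) ![y, p] ≤ 1) ?_ ?_ ?_ y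
  · rw [allLe, ev_lrn_zero, ev_leqF, lq_eq]
    split_ifs
    exacts [le_rfl, zero_le_one]
  · intro y hy
    rw [allLe, ev_lrn_even _ _ _ _ _ hy]
    refine (min_le_right _ _).trans ?_
    rw [ev_succF, ev_zeroF, zero_add]
  · intro y
    rw [allLe, ev_lrn_odd]
    refine (min_le_right _ _).trans ?_
    rw [ev_succF, ev_zeroF, zero_add]

theorem allLe_of_ne_zero {y : M} (hy : y ≠ 0) (p : M) : ev (allLe P Q) ![y, p] = 1 ↔
    ev (allLe P Q) ![hf y, p] = 1 ∧ ev P ![y, p] ≤ ev Q ![y, p] := by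
  revert hy
  refine binary_cases (P := fun y => y ≠ 0 → (ev (allLe P Q) ![y, p] = 1 ↔
    ev (allLe P Q) ![hf y, p] = 1 ∧ ev P ![y, p] ≤ ev Q ![y, p])) ?_ ?_ ?_ y
  · exact fun h => (h rfl).elim
  · intro y hy _
    rw [hf_add_self, ← min_mul_lq_eq_one (allLe_le_one P Q y p)]
    nth_rw 1 [allLe]
    rw [ev_lrn_even _ _ _ _ _ hy]
    simp only [ev_mulF, ev_leqF, ev_comp, ev_cons, ev_nil, ev_dblF, ev_succF, ev_zeroF, ev_proj,
      zero_add]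
    rfl
  · intro y _
    rw [hf_add_self_add_one, ← min_mul_lq_eq_one (allLe_le_one P Q y p)]
    nth_rw 1 [allLe]
    rw [ev_lrn_odd]
    simp only [ev_mulF, ev_leqF, ev_comp, ev_cons, ev_nil, ev_dblF, ev_succF, ev_zeroF, ev_proj,
      zero_add]
    rfl

theorem allLe_hf {y p : M} (h : ev (allLe P Q) ![y, p] = 1) :
    ev (allLe P Q) ![hf y, p] = 1 := by
  by_cases hy : y = 0
  · rw [hy] at h ⊢
    rwa [hf_zero]
  · exact ((allLe_of_ne_zero P Q hy p).1 h).1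

theorem le_of_allLe {y p : M} (h : ev (allLe P Q) ![y, p] = 1) :
    ev P ![y, p] ≤ ev Q ![y, p] := by
  by_cases hy : y = 0
  · rw [hy] at h ⊢
    exact (allLe_zero P Q p).1 h
  · exact ((allLe_of_ne_zero P Q hy p).1 h).2

theorem sh_self (x : M) : sh x x = 0 := by
  have h := ln_sh (le_refl (ln x))
  exact ln_eq_zero.1 (add_right_cancel (h.trans (zero_add _).symm))

/-- The value 1 is inherited by every shift of y. Conversely, if all the inequalities hold, a value
other than 1 is inherited as well, down to the shift 0 = `sh y y`, where it contradicts the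
inequality at 0. Both are open inductions on u. -/
theorem allLe_iff (y p : M) : ev (allLe P Q) ![y, p] = 1 ↔
    ∀ u, ev P ![sh u y, p] ≤ ev Q ![sh u y, p] := by
  constructor
  · intro h u
    refine le_of_allLe P Q ?_
    refine OpenPred.induction (P := fun u => ev (allLe P Q) ![sh u y, p] = 1)
      (.eq (.ev_two _ (.sh .id (.const _)) (.const _)) (.const _)) ?_ ?_ ?_ u
    · rwa [zero_sh]
    · intro u hu ih
      rw [double_sh hu]
      exact allLe_hf P Q ih
    · intro u ih
      rw [double_add_one_sh]
      exact allLe_hf P Q ih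
  · intro h
    by_contra hy
    have step (u : M) (ih : ev (allLe P Q) ![sh u y, p] ≠ 1) :
        ev (allLe P Q) ![hf (sh u y), p] ≠ 1 := by
      by_cases h0 : sh u y = 0
      · rwa [h0, hf_zero, ← h0]
      · exact fun e => ih ((allLe_of_ne_zero P Q h0 p).2 ⟨e, h u⟩)
    have key (u : M) : ev (allLe P Q) ![sh u y, p] ≠ 1 := by
      refine OpenPred.induction (P := fun u => ev (allLe P Q) ![sh u y, p] ≠ 1)
        (.not (.eq (.ev_two _ (.sh .id (.const _)) (.const _)) (.const _))) ?_ ?_ ?_ u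
      · rwa [zero_sh]
      · intro u hu ih
        rw [double_sh hu]
        exact step u ih
      · intro u ih
        rw [double_add_one_sh]
        exact step u ih
    have h1 := key y
    have h2 := h y
    rw [sh_self] at h1 h2
    exact h1 ((allLe_zero P Q p).2 h2)

end AllLe

/-! ### Binomial coefficients -/

/-- The function `k! (m - k)!` of `1^(k)` and `1^(m)`. -/
def binomDenom : PVFun 2 :=
  mulF (.comp fact ![.proj 0]) (.comp fact ![.comp shift ![.proj 0, .proj 1] ])

/-- The characteristic function of the predicate that `k! (m - k)!` divides `m!` for all `k ≤ m`,
as a function of `1^(m)`. -/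
def binomExact : PVFun 2 :=
  allLe (.comp fact ![.proj 1])
    (mulF binomDenom (.comp div ![.comp fact ![.proj 1], binomDenom]))

section Binomial

variable {M : Type} [pvLang.Structure M] [hM : M ⊨ PV1]

theorem Unary.exists_prefix {u w : M} (hw : Unary w) (h : ln u ≤ ln w) :
    ∃ v, Unary v ∧ ln u + ln v = ln w :=
  ⟨PV.sh u w, hw.sh u, by rw [add_comm, ln_sh h]⟩

/-- Divisibility of m! by d is the open condition m! ≤ d ⌊m!/d⌋. The shifts of 1^(m) are precisely
the 1^(k) with k ≤ m, so `allLe` quantifies over all k. -/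
theorem binomExact_iff {w : M} (hw : Unary w) : ev binomExact ![w, w] = 1 ↔
    ∀ u v : M, Unary u → Unary v → ln u + ln v = ln w → ∃ q, fc u * fc v * q = fc w := by
  rw [binomExact, allLe_iff]
  simp only [binomDenom, ev_mulF, ev_comp, ev_cons, ev_nil, ev_proj]
  change (∀ u, fc w ≤ fc (sh u w) * fc (sh (sh u w) w) *
    dv (fc w) (fc (sh u w) * fc (sh (sh u w) w))) ↔ _
  constructor
  · intro h u v hu hv e
    have h1 : sh v w = u := hu.sh_eq hw e
    have h2 : sh u w = v := hv.sh_eq hw (by rw [add_comm, e])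
    have h3 := h v
    rw [h1, h2] at h3
    exact ⟨_, le_antisymm (dv_spec (mul_ne_zero' (fc_ne_zero u) (fc_ne_zero v)) _).1 h3⟩
  · intro h u
    have hle : ln (sh u w) ≤ ln w := ln_mono (sh_le u w)
    obtain ⟨q, hq⟩ := h (sh u w) (sh (sh u w) w) (hw.sh u) (hw.sh _)
      (by rw [add_comm, ln_sh hle])
    rw [← hq, dv_mul (mul_ne_zero' (fc_ne_zero _) (fc_ne_zero _))]

theorem ln_eq_zero_add {x y z : M} (h : ln x + ln y = ln z) (hx : x = 0) : ln y = ln z := by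
  rwa [hx, ln_zero, zero_add] at h

/-- Let (k + 1) + (l + 1) = m + 1. If m! = k! (l + 1)! q₁ = (k + 1)! l! q₂, then multiplying by k +
1 and l + 1 and adding gives (m + 1)! = (k + 1)! (l + 1)! (q₁ + q₂). -/
theorem exists_mul_fc {u v w : M} (hu : Unary u) (hv : Unary v) (hw : Unary w)
    (h : ln u + ln v = ln w) : ∃ q, fc u * fc v * q = fc w := by
  -- The induction hypothesis is needed for all u and v; `binomExact` expresses this by an equation
  -- in w alone.
  suffices H : Unary w → ev binomExact ![w, w] = 1 from
    (binomExact_iff hw).1 (H hw) u v hu hv h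
  clear hu hv hw h
  refine OpenPred.induction (P := fun w => Unary w → ev binomExact ![w, w] = 1)
    (.imp (.unary .id) (.eq (.ev_two _ .id .id) (.const _))) ?_ ?_ ?_ w
  · intro hw
    rw [binomExact_iff hw]
    intro u v hu hv h
    rw [ln_zero] at h
    have h1 := zero_le' (ln u)
    have h2 := zero_le' (ln v)
    have hu0 : u = 0 := ln_eq_zero.1 (by grind)
    have hv0 : v = 0 := ln_eq_zero.1 (by grind)
    exact ⟨1, by rw [hu0, hv0, fc_zero, mul_one, mul_one]⟩
  · exact fun y hy _ h => (not_unary_double hy h).elim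
  · intro w ih hw'
    have hw := unary_double_add_one.1 hw'
    have ih := (binomExact_iff hw).1 (ih hw)
    rw [binomExact_iff hw']
    intro u v hu hv h
    obtain rfl | ⟨u, hu', rfl⟩ := hu.eq_zero_or
    · rw [hv.ext hw' (ln_eq_zero_add h rfl)]
      exact ⟨1, by rw [fc_zero, mul_one, one_mul]⟩
    obtain rfl | ⟨v, hv', rfl⟩ := hv.eq_zero_or
    · rw [hu.ext hw' (ln_eq_zero_add (by rwa [add_comm] at h) rfl)]
      exact ⟨1, by rw [fc_zero, mul_one, mul_one]⟩
    rw [ln_double_add_one, ln_double_add_one, ln_double_add_one] at h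
    have h' : ln u + ln v + 1 = ln w := by
      refine add_right_cancel (b := 1) (Eq.trans ?_ h)
      ring
    obtain ⟨q₁, hq₁⟩ := ih u (v + v + 1) hu' hv (by rw [ln_double_add_one, ← h', add_assoc])
    obtain ⟨q₂, hq₂⟩ := ih (u + u + 1) v hu hv'
      (by rw [ln_double_add_one, ← h']; ring)
    refine ⟨q₁ + q₂, ?_⟩
    rw [fc_double_add_one] at hq₁ hq₂
    rw [fc_double_add_one, fc_double_add_one, fc_double_add_one, ← h, mul_add, mul_add, mul_add]
    calc _ = fc u * (fc v * (ln v + 1)) * q₁ * (ln u + 1) +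
          fc u * (ln u + 1) * fc v * q₂ * (ln v + 1) := by ring
      _ = _ := by rw [hq₁, hq₂]; ring

theorem fc_mul_fc_mul_bn {u v w : M} (hu : Unary u) (hv : Unary v) (hw : Unary w)
    (h : ln u + ln v = ln w) : fc u * fc v * bn w u = fc w := by
  obtain ⟨q, hq⟩ := exists_mul_fc hu hv hw h
  rw [bn_eq, lq_eq_one.2 (h ▸ le_add_of_nonneg_right (zero_le' _)), one_mul,
    hv.sh_eq hw (by rw [add_comm, h])]
  rw [← hq, dv_mul (mul_ne_zero' (fc_ne_zero _) (fc_ne_zero _))]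

theorem bn_of_ln_lt {u w : M} (h : ln w < ln u) : bn w u = 0 := by
  rw [bn_eq, lq_of_not_le (not_le.2 h), zero_mul]

theorem bn_self {w : M} (hw : Unary w) : bn w w = 1 := by
  have h := fc_mul_fc_mul_bn hw unary_zero hw (by rw [ln_zero, add_zero])
  rw [fc_zero, mul_one] at h
  exact mul_left_cancel_of_ne_zero (fc_ne_zero w) (h.trans (mul_one _).symm)

theorem bn_zero {w : M} (hw : Unary w) : bn w 0 = 1 := by
  have h := fc_mul_fc_mul_bn unary_zero hw hw (by rw [ln_zero, zero_add])
  rw [fc_zero, one_mul] at h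
  exact mul_left_cancel_of_ne_zero (fc_ne_zero w) (h.trans (mul_one _).symm)

/-- Pascal's identity. -/
theorem bn_double_add_one {u w : M} (hu : Unary u) (hw : Unary w) :
    bn (w + w + 1) (u + u + 1) = bn w u + bn w (u + u + 1) := by
  have hu' := unary_double_add_one.2 hu
  have hw' := unary_double_add_one.2 hw
  have lu := ln_double_add_one u
  have lw := ln_double_add_one w
  rcases lt_trichotomy (ln u) (ln w) with h | h | h
  -- v = 1^(m - k - 1), so the three factorial formulas have the complements v + v + 1, v and v + v
  -- + 1.
  · obtain ⟨v, hv, e⟩ := hw.exists_prefix (u := u + u + 1) (by rwa [lu, ← lt_iff])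
    have hv' := unary_double_add_one.2 hv
    have lv := ln_double_add_one v
    have h₁ := fc_mul_fc_mul_bn hu hv' hw (by rw [lv, ← e, lu]; ring)
    have h₂ := fc_mul_fc_mul_bn hu' hv hw e
    have h₃ := fc_mul_fc_mul_bn hu' hv' hw' (by rw [lv, lw, ← e]; ring)
    refine mul_left_cancel_of_ne_zero (mul_ne_zero' (fc_ne_zero _) (fc_ne_zero _)) (h₃.trans ?_)
    rw [fc_double_add_one] at h₁ h₂ ⊢
    rw [fc_double_add_one, fc_double_add_one, ← e, lu]
    calc _ = fc w * (ln u + 1) + fc w * (ln v + 1) := by ring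
      _ = fc u * (fc v * (ln v + 1)) * bn w u * (ln u + 1) +
          fc u * (ln u + 1) * fc v * bn w (u + u + 1) * (ln v + 1) := by rw [h₁, h₂]
      _ = _ := by ring
  -- For k ≥ m the identity rests on the default value 0 of binom(m, k) for k > m.
  · obtain rfl := hu.ext hw h
    rw [bn_self hu', bn_self hu, bn_of_ln_lt (by rw [lu]; exact lt_add_one' _), add_zero]
  · rw [bn_of_ln_lt h, bn_of_ln_lt (by rw [lu, lw]; exact add_lt_add_left h 1),
      bn_of_ln_lt (by rw [lu]; exact h.trans (lt_add_one' _)), add_zero]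

end Binomial

/-! ### The combinatorial number system -/

/-- For `u = 1^(k)` and a number `z` with leading one followed by the digits `x`, the number of ones
that are still missing in `x`, in unary: `slots(0) = 2 * u + 1`,
`slots(2 * z) = slots(z)` and `slots(2 * z + 1) = ⌊slots(z)/2⌋`. -/
def slots : PVFun 2 :=
  .lrn (succF (dblF (.proj 0))) (.proj 1) (halfF (.proj 1)) (succF (dblF (.proj 1)))

/-- For `u = 1^(k)`, `w = 1^(m)` and a number `z` with leading one followed by the digits `x`, the
number of words of length `m` with `k` ones that precede all those that extend `x`. -/
def rank : PVFun 3 :=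
  .lrn zeroF (.proj 1)
    (addF (.proj 1) (mulF (leqF (succF zeroF) (.proj 0))
      (.comp binom ![.comp shift ![.proj 0, .proj 3], .comp slots ![.proj 0, .proj 2] ])))
    (.comp binom ![.proj 2, .proj 1])

/-- For `u = 1^(k)` and `w = 1^(m)`, the first `|y|` digits of the `i`-th word of length `m` with `k`
ones, as a function of `y`, `u`, `w`, `i`. -/
def unrankPrefix : PVFun 4 :=
  let y : PVFun 5 := .proj 0
  let x : PVFun 5 := .proj 1
  let u : PVFun 5 := .proj 2
  let w : PVFun 5 := .proj 3
  let i : PVFun 5 := .proj 4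
  let z : PVFun 5 := addF x (smashF (succF zeroF) y)
  let step : PVFun 5 := addF (dblF x) (leqF (succF (addF (.comp rank ![z, u, w])
    (.comp binom ![halfF (.comp shift ![y, w]), .comp slots ![z, u] ]))) i)
  .lrn zeroF step step (smashF (succF zeroF) (.proj 0))

/-- For `u = 1^(k)` and `w = 1^(m)`, the `i`-th number of length at most `m` with `k` ones, as a
function of `u`, `w`, `i`. -/
def unrank : PVFun 3 := .comp unrankPrefix ![.proj 1, .proj 0, .proj 1, .proj 2]

section Unrank

variable {M : Type} [pvLang.Structure M]

/-- The value of `slots` in a model. -/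
def sl (z u : M) : M := ev slots ![z, u]

/-- The value of `rank` in a model. -/
def rk (z u w : M) : M := ev rank ![z, u, w]

/-- The value of `unrankPrefix` in a model. -/
def ur (y u w i : M) : M := ev unrankPrefix ![y, u, w, i]

theorem TermFun.sl {g h : M → M} (hg : TermFun g) (hh : TermFun h) :
    TermFun fun x => sl (g x) (h x) := hg.ev_two slots hh

theorem TermFun.rk {g h k : M → M} (hg : TermFun g) (hh : TermFun h) (hk : TermFun k) :
    TermFun fun x => rk (g x) (h x) (k x) := hg.ev_three rank hh hk

theorem TermFun.ur {g h k l : M → M} (hg : TermFun g) (hh : TermFun h) (hk : TermFun k)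
    (hl : TermFun l) : TermFun fun x => ur (g x) (h x) (k x) (l x) :=
  hg.ev_four unrankPrefix hh hk hl

variable [hM : M ⊨ PV1]

theorem sl_zero (u : M) : sl 0 u = u + u + 1 := by
  rw [sl, slots, ev_lrn_zero, ev_succF, ev_dblF, ev_proj]; rfl

theorem sl_le (z u : M) : sl z u ≤ u + u + 1 := by
  refine binary_cases (P := fun z => sl z u ≤ u + u + 1) ?_ ?_ ?_ z
  · rw [sl_zero]
  · intro y hy
    rw [sl, slots, ev_lrn_even _ _ _ _ _ hy]
    refine (min_le_right _ _).trans_eq ?_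
    rw [ev_succF, ev_dblF, ev_proj]; rfl
  · intro y
    rw [sl, slots, ev_lrn_odd]
    refine (min_le_right _ _).trans_eq ?_
    rw [ev_succF, ev_dblF, ev_proj]; rfl

theorem sl_double (z u : M) : sl (z + z) u = sl z u := by
  by_cases hz : z = 0
  · rw [hz, add_zero]
  · rw [sl, slots, ev_lrn_even _ _ _ _ _ hz, ev_succF, ev_dblF, ev_proj, ev_proj]
    exact min_eq_left (sl_le z u)

theorem sl_double_add_one (z u : M) : sl (z + z + 1) u = hf (sl z u) := by
  rw [sl, slots, ev_lrn_odd, ev_succF, ev_dblF, ev_halfF, ev_proj, ev_proj]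
  exact min_eq_left ((hf_le _).trans (sl_le z u))

/-- The leading one of z is not a digit of the word; it halves the initial value 2u + 1 of `slots`
to u. -/
theorem sl_one (u : M) : sl 1 u = u := by
  have := sl_double_add_one 0 u
  rwa [sl_zero, hf_add_self_add_one, add_zero, zero_add] at this

theorem rk_zero (u w : M) : rk 0 u w = 0 := by
  rw [rk, rank, ev_lrn_zero, ev_zeroF]

theorem rk_le (z u w : M) : rk z u w ≤ bn w u := by
  refine binary_cases (P := fun z => rk z u w ≤ bn w u) ?_ ?_ ?_ z
  · rw [rk_zero]
    exact zero_le' _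
  · intro y hy
    rw [rk, rank, ev_lrn_even _ _ _ _ _ hy]
    refine (min_le_right _ _).trans_eq ?_
    rw [ev_comp, ev_cons, ev_cons, ev_nil, ev_proj, ev_proj]; rfl
  · intro y
    rw [rk, rank, ev_lrn_odd]
    refine (min_le_right _ _).trans_eq ?_
    rw [ev_comp, ev_cons, ev_cons, ev_nil, ev_proj, ev_proj]; rfl

theorem rk_double (z u w : M) : rk (z + z) u w = rk z u w := by
  by_cases hz : z = 0
  · rw [hz, add_zero]
  · rw [rk, rank, ev_lrn_even _ _ _ _ _ hz, ev_comp, ev_cons, ev_cons, ev_nil, ev_proj, ev_proj,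
      ev_proj]
    exact min_eq_left (rk_le z u w)

theorem rk_double_add_one (z u w : M) : rk (z + z + 1) u w =
    min (rk z u w + lq 1 z * bn (sh z w) (sl z u)) (bn w u) := by
  rw [rk, rank, ev_lrn_odd]
  simp only [ev_comp, ev_cons, ev_nil, ev_proj, ev_addF, ev_mulF, ev_leqF, ev_succF, ev_zeroF,
    zero_add]
  rfl

/-- The factor `lq 1 z` is 0 at the leading one, which therefore does not contribute to the rank. -/
theorem rk_one (u w : M) : rk 1 u w = 0 := by
  have := rk_double_add_one 0 u w
  rwa [rk_zero, lq_of_not_le (not_le.2 zero_lt_one), zero_mul, add_zero, zero_add,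
    min_eq_left (zero_le' _)] at this

theorem ur_zero (u w i : M) : ur 0 u w i = 0 := by
  rw [ur, unrankPrefix, ev_lrn_zero, ev_zeroF]

theorem ur_double {y : M} (hy : y ≠ 0) (u w i : M) : ur (y + y) u w i =
    min (ur y u w i + ur y u w i + lq (rk (ur y u w i + sm 1 y) u w +
      bn (hf (sh y w)) (sl (ur y u w i + sm 1 y) u) + 1) i) (sm 1 (y + y)) := by
  rw [ur, unrankPrefix, ev_lrn_even _ _ _ _ _ hy]
  simp only [ev_comp, ev_cons, ev_nil, ev_proj, ev_addF, ev_dblF, ev_leqF, ev_succF, ev_zeroF,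
    ev_smashF, ev_halfF, zero_add]
  rfl

theorem ur_double_add_one (y u w i : M) : ur (y + y + 1) u w i =
    min (ur y u w i + ur y u w i + lq (rk (ur y u w i + sm 1 y) u w +
      bn (hf (sh y w)) (sl (ur y u w i + sm 1 y) u) + 1) i) (sm 1 (y + y + 1)) := by
  rw [ur, unrankPrefix, ev_lrn_odd]
  simp only [ev_comp, ev_cons, ev_nil, ev_proj, ev_addF, ev_dblF, ev_leqF, ev_succF, ev_zeroF,
    ev_smashF, ev_halfF, zero_add]
  rfl

/-- The digits `x` are the first `|y|` digits of the `i`-th word of length `|w|` with `|u|` ones. -/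
def IsPrefix (u w i x y : M) : Prop :=
  x + 1 ≤ sm 1 y ∧ ln x ≤ ln y ∧ ln (x + sm 1 y) = ln y + 1 ∧ Unary (sl (x + sm 1 y) u) ∧
    no x + ln (sl (x + sm 1 y) u) = ln u ∧ rk (x + sm 1 y) u w < i ∧
    i ≤ rk (x + sm 1 y) u w + bn (sh y w) (sl (x + sm 1 y) u)

/-- One digit of the unranking. Only the length of y matters, so y' stands for both 2y and 2y + 1.
The minimum in the recursion for x' is resolved by x < 2 ^ |y|. -/
theorem IsPrefix.step {u w i x y x' y' : M} (hw : Unary w) (hi : i ≤ bn w u)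
    (h : IsPrefix u w i x y) (hy : ln y + 1 ≤ ln w) (l' : ln y' = ln y + 1)
    (p' : sm 1 y' = sm 1 y + sm 1 y) (r' : sh y' w = hf (sh y w))
    (hx' : x' = min (x + x + lq (rk (x + sm 1 y) u w +
      bn (hf (sh y w)) (sl (x + sm 1 y) u) + 1) i) (sm 1 y')) :
    IsPrefix u w i x' y' := by
  obtain ⟨h1, h2, h3, h4, h5, h6, h7⟩ := h
  have hr : ln (sh y w) + ln y = ln w := ln_sh ((lt_add_one' _).le.trans hy)
  obtain hr0 | ⟨r, hru, hre⟩ := (hw.sh y).eq_zero_or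
  · rw [hr0, ln_zero, zero_add] at hr
    exact (not_lt.2 hy (hr ▸ lt_add_one' _)).elim
  rw [hre, hf_add_self_add_one] at hx' r'
  rw [hre] at h7 hr
  set z := x + sm 1 y with hz
  have hz0 : z ≠ 0 := by
    intro e
    rw [e, ln_zero] at h3
    exact add_one_ne_zero _ h3.symm
  have h01 := zero_lt_one (α := M)
  have hx0 := zero_le' x
  rw [lq_eq] at hx'
  split_ifs at hx' with hc
  -- The next digit is 1: the binom(r, s) words that continue with 0 are skipped.
  · rw [min_eq_left (by rw [p']; grind)] at hx'
    have hz' : x' + sm 1 y' = z + z + 1 := by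
      rw [hx', p', hz]; ring
    have hs : sh z w = r := hru.sh_eq hw (by
      rw [h3, ← hr, ln_double_add_one]; ring)
    have hrk : rk (z + z + 1) u w = rk z u w + bn r (sl z u) := by
      rw [rk_double_add_one, hs, lq_eq_one.2 (one_le_iff.2 hz0), one_mul]
      -- The new rank is below i, hence below the limiting term binom(m, k).
      exact min_eq_left ((lt_add_one' _).le.trans (hc.trans hi))
    -- If no one is missing, just one word extends the prefix, and it continues with 0, so the digit
    -- 1 is not chosen.
    obtain hk0 | ⟨k, hku, hk⟩ := h4.eq_zero_or
    · rw [hk0, bn_zero hru] at hc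
      rw [hk0, bn_zero (unary_double_add_one.2 hru)] at h7
      exact (not_lt.2 (hc.trans h7) (lt_add_one' _)).elim
    rw [hk, bn_double_add_one hku hru] at h7
    rw [hk, ln_double_add_one] at h5
    rw [IsPrefix, hz', sl_double_add_one, hrk, r', hk, hf_add_self_add_one, hx', p', l',
      ln_double_add_one, ln_double_add_one, no_double_add_one, h3]
    rw [hk] at hc
    refine ⟨by grind, add_le_add_left h2 1, rfl, hku, ?_, lt_iff.2 hc, ?_⟩
    · rw [← h5]; ring
    · grind
  -- The next digit is 0: the rank stays, and the failed comparison is the new upper bound for i.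
  · rw [add_zero, min_eq_left (by rw [p']; grind)] at hx'
    have hz' : x' + sm 1 y' = z + z := by
      rw [hx', p', hz]; ring
    rw [IsPrefix, hz', sl_double, rk_double, r', hx', p', l', ln_double hz0, no_double, h3]
    refine ⟨by grind, ?_, rfl, h4, h5, h6, ?_⟩
    · by_cases hx : x = 0
      · rw [hx, add_zero, ln_zero]
        exact zero_le' _
      · rw [ln_double hx]
        exact add_le_add_left h2 1
    · rwa [← lt_iff, not_lt] at hc

theorem isPrefix_ur {u w i y : M} (hu : Unary u) (hw : Unary w) (hi : 0 < i) (hi' : i ≤ bn w u)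
    (hy : ln y ≤ ln w) : IsPrefix u w i (ur y u w i) y := by
  revert hy
  refine OpenPred.induction (P := fun y => ln y ≤ ln w → IsPrefix u w i (ur y u w i) y)
    (.imp (.le (.ln .id) (.const _)) ?_) ?_ ?_ ?_ y
  -- The invariant is a conjunction of equations and inequalities between terms in y, hence open.
  · have ht : TermFun fun y => ur y u w i := .ur .id (.const _) (.const _) (.const _)
    have hz : TermFun fun y => ur y u w i + sm 1 y := ht.add (.sm (.const _) .id)
    have hs : TermFun fun y => sl (ur y u w i + sm 1 y) u := .sl hz (.const _)
    have hr : TermFun fun y => rk (ur y u w i + sm 1 y) u w := .rk hz (.const _) (.const _)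
    exact .and (.le (.add ht (.const _)) (.sm (.const _) .id)) (.and (.le (.ln ht) (.ln .id))
      (.and (.eq (.ln hz) (.add (.ln .id) (.const _))) (.and (.unary hs)
      (.and (.eq (.add (.no ht) (.ln hs)) (.const _)) (.and (.lt hr (.const _))
      (.le (.const _) (.add hr (.bn (.sh .id (.const _)) hs))))))))
  · intro
    rw [IsPrefix, ur_zero, one_sm_zero, zero_add, ln_one, ln_zero, sl_one, rk_one, zero_sh,
      no_zero, zero_add, zero_add, zero_add]
    exact ⟨le_rfl, le_rfl, rfl, hu, rfl, hi, hi'⟩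
  · intro y hy ih h
    rw [ln_double hy] at h
    exact (ih ((lt_add_one' _).le.trans h)).step hw hi' h (ln_double hy) (one_sm_double hy)
      (double_sh hy w) (ur_double hy u w i)
  · intro y ih h
    rw [ln_double_add_one] at h
    exact (ih ((lt_add_one' _).le.trans h)).step hw hi' h (ln_double_add_one y)
      (one_sm_double_add_one y) (double_add_one_sh y w) (ur_double_add_one y u w i)

/-- At y = w no digits remain. A missing one would make the binomial coefficient 0 and the interval
for i empty; otherwise the coefficient is 1 and the interval is the single point rank + 1. -/
theorem ur_spec {u w i : M} (hu : Unary u) (hw : Unary w) (hi : 0 < i) (hi' : i ≤ bn w u) :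
    ln (ur w u w i) ≤ ln w ∧ no (ur w u w i) = ln u ∧
      i = rk (ur w u w i + sm 1 w) u w + 1 := by
  obtain ⟨-, h2, -, -, h5, h6, h7⟩ := isPrefix_ur hu hw hi hi' le_rfl
  rw [sh_self] at h7
  by_cases hk : sl (ur w u w i + sm 1 w) u = 0
  · rw [hk, bn_zero unary_zero] at h7
    rw [hk, ln_zero, add_zero] at h5
    exact ⟨h2, h5, le_antisymm h7 (lt_iff.1 h6)⟩
  · have hlt : ln (0 : M) < ln (sl (ur w u w i + sm 1 w) u) := by
      rw [ln_zero]
      exact lt_of_le_of_ne (zero_le' _) fun e => hk (ln_eq_zero.1 e.symm)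
    rw [bn_of_ln_lt hlt, add_zero] at h7
    exact (not_lt.2 h7 h6).elim

theorem ev_unrank (u w i : M) : ev unrank ![u, w, i] = ur w u w i := by
  rw [unrank]
  simp only [ev_comp, ev_cons, ev_nil, ev_proj]
  rfl

theorem ev_cSym {u w x : M} (h : ln x ≤ ln w) (h' : no x = ln u) : ev cSym ![u, w, x] = 1 := by
  rw [cSym]
  simp only [ev_mulF, ev_leqF, ev_lenF, ev_comp, ev_cons, ev_nil, ev_proj]
  change lq (ln x) (ln w) * (lq (no x) (ln u) * lq (ln u) (no x)) = 1
  rw [lq_eq_one.2 h, lq_eq_one.2 h'.le, lq_eq_one.2 h'.ge, one_mul, one_mul]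

theorem realize_injectsBinom (a : Fin 4 → M) : (injectsBinom unrank).Realize a := by
  have hD {i : M} (h : (0 ≤ i ∧ 0 ≠ i) ∧ i ≤ bn (a 1) (a 0)) : 0 < i ∧ i ≤ bn (a 1) (a 0) :=
    ⟨lt_of_le_of_ne h.1.1 h.1.2, h.2⟩
  simp only [injectsBinom, isUnary, inDomain, Formula.realize_imp, Formula.realize_inf, realize_eq,
    realize_le, realize_ne, realize_zero, realize_len, realize_app, realize_cons, realize_nil,
    realize_var, realize_one, ev_unrank]
  rintro ⟨⟨hu, hw⟩, -⟩
  constructor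
  · intro h
    obtain ⟨hi, hi'⟩ := hD h
    obtain ⟨h1, h2, -⟩ := ur_spec hu hw hi hi'
    exact ev_cSym h1 h2
  · rintro ⟨⟨h, h'⟩, e⟩
    obtain ⟨hi, hi'⟩ := hD h
    obtain ⟨hj, hj'⟩ := hD h'
    -- Both i and j are one more than the rank of the same word.
    rw [(ur_spec hu hw hi hi').2.2, (ur_spec hu hw hj hj').2.2, e]

end Unrank

end PV

theorem mainTheorem11 : ∃ f : PVFun 3, PV.PV1 ⊨ᵇ PV.injectsBinom f :=
  ⟨PV.unrank, fun M a xs => by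
    rw [Subsingleton.elim xs default]
    exact PV.realize_injectsBinom a⟩
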